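/- **Notation.** Let $\mathrm{Sym}(\mathbb C^2)=\mathbb C[x_1,x_2]$ and let $\pi_n$ be the representation of $SU(2)$ in $\mathrm{Sym}^n(\mathbb C^2)$. For a finite subgroup $\Gamma\subset SU(2)$ let $\rho$ be its inclusion in $SU(2)$ (the representation $\pi_1|\Gamma$), and let $P(\mathrm{Sym}(\mathbb C^2)^\Gamma,t)=\sum_{n\ge0}\dim\big(\mathrm{Sym}^n(\mathbb C^2)^\Gamma\big)t^n$ be the Poincaré series of its algebra of invariants. Write $\langle\alpha,\beta\rangle_\Gamma=\frac1{|\Gamma|}\sum_{g\in\Gamma}\alpha(g)\overline{\beta(g)}$ for characters; identities between representations are understood as identities between their characters. For a square matrix $K=(k_{ij})$ with integer entries and $k_{ii}=2$, the simple reflections are $s_i(\alpha_j)=\alpha_j-k_{ij}\alpha_i$. The diagram of $K$ joins $i\ne j$ if $k_{ij}\neq0$ or $k_{ji}\ne 0$. A Coxeter transformation of $K$ is the product of all $s_i$, each taken once, in an arbitrary order if the diagram has no cycles, and in general in a bicolored order: first all vertices of one color, then all vertices of the other color, where no two vertices of the same color are joined. $K$ is the Cartan matrix of an extended Dynkin diagram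 (is of affine type) if $k_{ii}=2$, $k_{ij}\le0$ for $i\neq j$, $k_{ij}=0$ implies $k_{ji}=0$, the diagram is connected, and $K\delta=0$ for some vector $\delta$ with positive integer coordinates. **Theorem (generalized Ebeling theorem).** Let $G\subset SU(2)$ be a finite subgroup. 1. (McKay operator.) Let $|G|$ be even, so that $G$ is a binary polyhedral group other than a cyclic group of odd order. Let $\rho_0,\dots,\rho_r$ be the distinct irreducible complex representations of $G$, where $\rho_0$ is trivial, let $B=A=(a_{jk})$ be the unique matrix of non-negative integers with $\rho\otimes\rho_j=\bigoplus_k a_{jk}\rho_k$, and put $[P_G(t)]_0=\sum_n\langle\pi_n|G,\rho_0\rangle_G t^n$. Then $[P_G(t)]_0=P(\mathrm{Sym}(\mathbb C^2)^G,t)$. 2. (Slodowy operators.) Let $H\triangleleft G$ be a normal subgroup of even order with cyclic quotient $G/H$ (as for the pairs of binary polyhedral groups $\mathcal D_2\triangleleft\mathcal T$, $\mathcal T\triangleleft\mathcal O$, $\mathcal D_{m}\triangleleft\mathcal D_{2m}$, $\mathbb Z/2m\mathbb Z\triangleleft\mathcal D_m$). (a) Let $\rho_0^\downarrow,\dots,\rho_r^\downarrow$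 be the distinct restrictions to $H$ of irreducible representations of $G$, where $\rho_0^\downarrow$ is the restriction of the trivial one. There is a unique matrix $B=\tilde A=(a_{ij})$ of non-negative integers with $\rho\otimes\rho_i^\downarrow=\bigoplus_j a_{ji}\rho_j^\downarrow$. Put $[P(t)]_0=\sum_n\langle\pi_n|H,\rho_0^\downarrow\rangle_H t^n$. Then $[P(t)]_0=P(\mathrm{Sym}(\mathbb C^2)^H,t)$. (b) Let $\tau_0^\uparrow,\dots,\tau_r^\uparrow$ be the distinct representations of $G$ induced from irreducible representations of $H$, where $\tau_0^\uparrow$ is induced from the trivial one. There is a unique matrix $B=\tilde A^\vee=(b_{ij})$ of non-negative integers with $\rho\otimes\tau_i^\uparrow=\bigoplus_j b_{ji}\tau_j^\uparrow$. Put $[P(t)]_0=\sum_n\langle\pi_n|G,\tau_0^\uparrow\rangle_G t^n$. Then $[P(t)]_0=P(\mathrm{Sym}(\mathbb C^2)^H,t)$. In each of the three cases $K=2I-B$ is the Cartan matrix of an extended Dynkin diagram, and this diagram has a bicolored order. If ${\bf C}_a$ is a Coxeter transformation of $K$ (the affine Coxeter transformation) and ${\bf C}$ is a Coxeter transformation of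 the matrix obtained from $K$ by deleting the row and the column with index $0$, then $\det(t^2I-{\bf C}_a)$ does not vanish at $t=0$, and in $\mathbb C[[t]]$ $$[P(t)]_0=\frac{\det(t^2I-{\bf C})}{\det(t^2I-{\bf C}_a)},$$ where in case 1 $[P(t)]_0$ means $[P_G(t)]_0$. -/

import Mathlib

open scoped ComplexConjugate

noncomputable section

/-! ### The group `SU(2)` and its action on `Sym(ℂ²) = ℂ[x₁, x₂]` -/

/-- The group `SU(2)`. -/
abbrev SU2 : Type := Matrix.specialUnitaryGroup (Fin 2) ℂ

/-- The linear substitution `x_j ↦ ∑ i, g i j x_i` of `ℂ[x₁, x₂]`, that is, the action on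
`Sym(ℂ²)` of the linear operator on `ℂ²` with matrix `g`. -/
def linSubst (g : Matrix (Fin 2) (Fin 2) ℂ) :
    MvPolynomial (Fin 2) ℂ →ₐ[ℂ] MvPolynomial (Fin 2) ℂ :=
  MvPolynomial.aeval fun j => ∑ i, MvPolynomial.C (g i j) * MvPolynomial.X i

theorem linSubst_one : linSubst 1 = AlgHom.id ℂ _ := by
  ext j
  fin_cases j <;> simp [linSubst]

theorem linSubst_mul (g h : Matrix (Fin 2) (Fin 2) ℂ) :
    linSubst (g * h) = (linSubst g).comp (linSubst h) := by
  apply MvPolynomial.algHom_ext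
  intro j
  rw [AlgHom.comp_apply]
  simp only [linSubst, MvPolynomial.aeval_X, Matrix.mul_apply, Fin.sum_univ_two, map_add,
    map_mul, MvPolynomial.algHom_C, MvPolynomial.algebraMap_eq]
  ring

theorem linSubst_mem (g : Matrix (Fin 2) (Fin 2) ℂ) (n : ℕ) (p : MvPolynomial (Fin 2) ℂ)
    (hp : p ∈ MvPolynomial.homogeneousSubmodule (Fin 2) ℂ n) :
    linSubst g p ∈ MvPolynomial.homogeneousSubmodule (Fin 2) ℂ n := by
  rw [MvPolynomial.mem_homogeneousSubmodule] at hp ⊢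
  have h := hp.aeval (fun j => ∑ i, MvPolynomial.C (g i j) * MvPolynomial.X i) (n := 1)
    (fun j => MvPolynomial.IsHomogeneous.sum _ _ _ fun i _ => by
      simpa using (MvPolynomial.isHomogeneous_C (Fin 2) (g i j)).mul
        (MvPolynomial.isHomogeneous_X ℂ i))
  simpa [linSubst] using h

/-- The representation `π_n` of `SU(2)` in `Sym^n(ℂ²)`. -/
def symPow (n : ℕ) :
    Representation ℂ SU2 (MvPolynomial.homogeneousSubmodule (Fin 2) ℂ n) where
  toFun g := (linSubst (g : Matrix (Fin 2) (Fin 2) ℂ)).toLinearMap.restrict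
    fun p hp => linSubst_mem _ n p hp
  map_one' := by
    ext1 p
    apply Subtype.ext
    simp [linSubst_one]
  map_mul' g h := by
    ext1 p
    apply Subtype.ext
    change linSubst ((g : Matrix (Fin 2) (Fin 2) ℂ) * (h : Matrix (Fin 2) (Fin 2) ℂ)) _ = _
    rw [linSubst_mul]
    rfl

/-- The algebra of invariants `Sym(ℂ²)^Γ` of a group `Γ` that acts through `φ : Γ → SU(2)`. -/
def invariantAlgebra {Γ : Type*} [Group Γ] (φ : Γ →* SU2) :
    Subalgebra ℂ (MvPolynomial (Fin 2) ℂ) where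
  carrier := {p | ∀ γ, linSubst (φ γ : Matrix (Fin 2) (Fin 2) ℂ) p = p}
  mul_mem' ha hb γ := by rw [map_mul, ha γ, hb γ]
  add_mem' ha hb γ := by rw [map_add, ha γ, hb γ]
  algebraMap_mem' c γ := AlgHom.commutes _ c

/-- The Poincaré series of the graded algebra `Sym(ℂ²)^Γ`. -/
def poincareSeries {Γ : Type*} [Group Γ] (φ : Γ →* SU2) : PowerSeries ℂ :=
  PowerSeries.mk fun n => (Module.finrank ℂ
    ↥(MvPolynomial.homogeneousSubmodule (Fin 2) ℂ n ⊓
      Subalgebra.toSubmodule (invariantAlgebra φ)) : ℂ)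

/-! ### Characters -/

/-- The set of characters of the irreducible finite-dimensional complex representations. -/
def irrChars (Γ : Type) [Group Γ] : Set (Γ → ℂ) :=
  {χ | ∃ (V : Type) (_ : AddCommGroup V) (_ : Module ℂ V) (_ : FiniteDimensional ℂ V)
    (ρ : Representation ℂ Γ V), ρ.IsIrreducible ∧ χ = ρ.character}

/-- The set of characters of the restrictions to `H` of the irreducible representations
of `Γ`. -/
def restrictedChars {Γ : Type} [Group Γ] (H : Subgroup Γ) : Set (H → ℂ) :=
  {χ | ∃ (V : Type) (_ : AddCommGroup V) (_ : Module ℂ V) (_ : FiniteDimensional ℂ V)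
    (ρ : Representation ℂ Γ V), ρ.IsIrreducible ∧
      χ = Representation.character (ρ.comp H.subtype)}

/-- The set of characters of the representations of `Γ` induced from the irreducible
representations of `H`. -/
def inducedChars {Γ : Type} [Group Γ] (H : Subgroup Γ) : Set (Γ → ℂ) :=
  {χ | ∃ (V : Type) (_ : AddCommGroup V) (_ : Module ℂ V) (_ : FiniteDimensional ℂ V)
    (τ : Representation ℂ H V), τ.IsIrreducible ∧
      χ = (Representation.ind H.subtype τ).character}

/-- The character of the trivial one-dimensional representation. -/
def trivialChar (Γ : Type) [Group Γ] : Γ → ℂ :=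
  (Representation.trivial ℂ Γ ℂ).character

/-- The family `χ` lists every element of `S` exactly once. -/
def Enumerates {r : ℕ} {X : Type*} (χ : Fin (r + 1) → X) (S : Set X) : Prop :=
  Function.Injective χ ∧ Set.range χ = S

/-- The inner product `⟨α, β⟩ = |Γ|⁻¹ ∑ g, α g * conj (β g)`. -/
def charInner {Γ : Type*} [Fintype Γ] (α β : Γ → ℂ) : ℂ :=
  (Fintype.card Γ : ℂ)⁻¹ * ∑ g, α g * conj (β g)

/-- The generating function `∑ n, ⟨π_n|Γ, χ⟩ t ^ n`. -/
def kostantSeries {Γ : Type*} [Group Γ] [Fintype Γ] (φ : Γ →* SU2) (χ : Γ → ℂ) :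
    PowerSeries ℂ :=
  PowerSeries.mk fun n => charInner (Representation.character ((symPow n).comp φ)) χ

/-- The character of the two-dimensional representation `φ : Γ → SU(2)`. -/
def stdChar {Γ : Type*} [Group Γ] (φ : Γ →* SU2) (γ : Γ) : ℂ :=
  (φ γ : Matrix (Fin 2) (Fin 2) ℂ).trace

/-- The decomposition formula `ρ ⊗ ρ_i = ⨁ j, a i j ρ_j` for the two-dimensional
representation `ρ` given by `φ` and the representations `ρ_i` with characters `χ i`. -/
def IsTensorMatrix {Γ : Type*} [Group Γ] (φ : Γ →* SU2) {r : ℕ} (χ : Fin (r + 1) → Γ → ℂ)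
    (a : Matrix (Fin (r + 1)) (Fin (r + 1)) ℕ) : Prop :=
  ∀ i γ, stdChar φ γ * χ i γ = ∑ j, (a i j : ℂ) * χ j γ

/-! ### Cartan matrices and Coxeter transformations -/

section Cartan

variable {ι : Type*} [Fintype ι] [DecidableEq ι]

/-- The diagram of `K` without multiplicities: distinct `i`, `j` are joined if `K i j` or
`K j i` is not zero. -/
def diagram (K : Matrix ι ι ℤ) : SimpleGraph ι :=
  SimpleGraph.fromRel fun i j => K i j ≠ 0

/-- Indecomposable generalized Cartan matrices of affine type, that is, the Cartan matrices
of the (possibly multiply-laced) extended Dynkin diagrams. -/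
structure IsAffineCartan (K : Matrix ι ι ℤ) : Prop where
  diag : ∀ i, K i i = 2
  off_diag : ∀ i j, i ≠ j → K i j ≤ 0
  zero_symm : ∀ i j, K i j = 0 → K j i = 0
  connected : (diagram K).Connected
  null_vector : ∃ δ : ι → ℤ, (∀ i, 0 < δ i) ∧ K.mulVec δ = 0

/-- The simple reflection `α_j ↦ α_j - K i j α_i` of the root lattice, in the basis of the
simple roots. -/
def simpleReflection (K : Matrix ι ι ℤ) (i : ι) : Matrix ι ι ℤ :=
  1 - Matrix.single i i 1 * K

/-- The product of the simple reflections in the order given by `l`. -/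
def coxeterTransformation (K : Matrix ι ι ℤ) (l : List ι) : Matrix ι ι ℤ :=
  (l.map (simpleReflection K)).prod

/-- The list `l` contains every vertex exactly once. -/
def IsVertexOrder (l : List ι) : Prop :=
  l.Nodup ∧ ∀ i, i ∈ l

/-- A vertex order is bicolored if it runs through all vertices of one color, then through all
vertices of the other one, where vertices of the same color are not joined. -/
def IsBicoloredOrder (K : Matrix ι ι ℤ) (l : List ι) : Prop :=
  IsVertexOrder l ∧ ∃ l₁ l₂ : List ι, l = l₁ ++ l₂ ∧
    (∀ i ∈ l₁, ∀ j ∈ l₁, ¬ (diagram K).Adj i j) ∧ (∀ i ∈ l₂, ∀ j ∈ l₂, ¬ (diagram K).Adj i j)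

/-- The orders that define Coxeter transformations: all orders if the diagram has no cycles,
and the bicolored orders in general. -/
def IsCoxeterOrder (K : Matrix ι ι ℤ) (l : List ι) : Prop :=
  IsVertexOrder l ∧ ((diagram K).IsAcyclic ∨ IsBicoloredOrder K l)

/-- The determinant `det (t ^ 2 I - C)`, as an element of `ℂ⟦t⟧`. -/
def detSq (C : Matrix ι ι ℤ) : PowerSeries ℂ :=
  (Matrix.det ((PowerSeries.X ^ 2 : PowerSeries ℂ) • (1 : Matrix ι ι (PowerSeries ℂ)) -
    C.map fun a => ((a : ℤ) : PowerSeries ℂ)))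

end Cartan

/-- The matrix `2I - B`. -/
def cartanOf {r : ℕ} (B : Matrix (Fin (r + 1)) (Fin (r + 1)) ℕ) :
    Matrix (Fin (r + 1)) (Fin (r + 1)) ℤ :=
  (2 : ℤ) • 1 - B.map fun a => (a : ℤ)

/-- The Cartan matrix of the diagram without the vertex `0`. -/
def deleteZero {r : ℕ} (K : Matrix (Fin (r + 1)) (Fin (r + 1)) ℤ) : Matrix (Fin r) (Fin r) ℤ :=
  K.submatrix Fin.succ Fin.succ

/-- `K = 2I - B` is the Cartan matrix of an extended Dynkin diagram, whose affine Coxeter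
transformation `C_a` exists, and `P = det (t ^ 2 I - C) / det (t ^ 2 I - C_a)`, where `C` is the
Coxeter transformation of the diagram without the vertex `0`. -/
def EbelingFormula {r : ℕ} (B : Matrix (Fin (r + 1)) (Fin (r + 1)) ℕ) (P : PowerSeries ℂ) :
    Prop :=
  IsAffineCartan (cartanOf B) ∧
  (∃ l, IsBicoloredOrder (cartanOf B) l) ∧
  ∀ (l : List (Fin (r + 1))) (l₀ : List (Fin r)),
    IsCoxeterOrder (cartanOf B) l → IsCoxeterOrder (deleteZero (cartanOf B)) l₀ →
    PowerSeries.constantCoeff (detSq (coxeterTransformation (cartanOf B) l)) ≠ 0 ∧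
    P = detSq (coxeterTransformation (deleteZero (cartanOf B)) l₀) *
      (detSq (coxeterTransformation (cartanOf B) l))⁻¹

end

/-! Let P_i(t) = Σ_n ⟨π_n, χ_i⟩ tⁿ be the multiplicity series of a family χ_i with ρ χ_i = Σ_j B_ji
χ_j. Clebsch–Gordan, ρ ⊗ π_{n+1} = π_{n+2} ⊕ π_n, and self-adjointness of multiplication by the
character of ρ combine into the linear system ((1 + t²)I − tBᵀ) P = e₀
(`transpose_coxeterPencil_mulVec`). Cramer's rule then gives P_0 as the determinant of (1 + t²)I −
tB without index 0, divided by the full determinant.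

Both determinants are characteristic polynomials of Coxeter transformations at t²
(`IsCoxeterOrder.detSq_eq`). Write K = N + N', where N and N' are unitriangular, above and below the
diagonal in the chosen order. The product of reflections is C = −N⁻¹N', so det(t²I − C) = det(t²N +
N'). Conjugation by diag(t^h), with h dropping by one along every edge in the direction of the
order, replaces the off-diagonal factors t² and 1 by t and t. Such h exists for every order on a
forest and for bicolored orders in general.

The three cases share the properties collected in `IsMcKayFamily`. The element −1 splits the indices
by parity and ρ switches parity, so the diagram is bipartite. Degrees and norms yield the positive
null vector. If it is cut down to a union of components, it defines a function f with ρ f = 2f; as ρ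
is faithful, f lives on the identity alone and pairs nontrivially with every χ_j, so the diagram is
connected. Orthogonality comes from Schur's lemma for irreducibles, from twisting by characters of
the cyclic quotient for restrictions, and from Frobenius reciprocity with conjugation by G for
induced characters. -/

/-! ### Potentials on forests -/

/-- Every antisymmetric function on the edges of a finite forest is a coboundary. -/
theorem SimpleGraph.IsAcyclic.exists_potential {V : Type*} [Finite V] {G : SimpleGraph V}
    (hG : G.IsAcyclic) (w : V → V → ℤ) (hw : ∀ u v, w v u = -w u v) :
    ∃ h : V → ℤ, ∀ u v, G.Adj u v → h u - h v = w u v := by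
  classical
  induction G using WellFoundedLT.induction with
  | ind G ih =>
    by_cases he : ∃ u v, G.Adj u v
    · obtain ⟨u, v, huv⟩ := he
      set G' := G \ SimpleGraph.fromEdgeSet {s(u, v)} with hG'
      have hle : G' ≤ G := sdiff_le
      have hlt : G' < G := lt_of_le_of_ne hle fun h => by
        have : G'.Adj u v := h ▸ huv
        simp [hG', huv.ne] at this
      obtain ⟨h, hh⟩ := ih G' hlt (hG.anti hle)
      have hb : ¬ G'.Reachable u v := by
        have := (SimpleGraph.isAcyclic_iff_forall_adj_isBridge.1 hG) huv
        rw [SimpleGraph.isBridge_iff] at this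
        exact this
      -- The removed edge is a bridge, so the component of `u` in `G'` misses `v`. A constant shift
      -- on that component corrects the difference across the bridge and changes no other one.
      refine ⟨fun x => h x + if G'.Reachable u x then w u v - (h u - h v) else 0, ?_⟩
      have key : ∀ a b, G.Adj a b → ¬ G'.Adj a b → (a = u ∧ b = v) ∨ (a = v ∧ b = u) := by
        intro a b hab hab'
        by_contra hcon
        apply hab'
        simp only [hG', SimpleGraph.sdiff_adj, SimpleGraph.fromEdgeSet_adj,
          Set.mem_singleton_iff, Sym2.eq_iff]
        exact ⟨hab, fun hc => hcon hc.1⟩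
      intro a b hab
      by_cases hab' : G'.Adj a b
      · have : G'.Reachable u a ↔ G'.Reachable u b :=
          ⟨fun h => h.trans hab'.reachable, fun h => h.trans hab'.symm.reachable⟩
        have h2 := hh a b hab'
        simp only [this]
        linarith
      · rcases key a b hab hab' with ⟨rfl, rfl⟩ | ⟨rfl, rfl⟩
        · simp only [SimpleGraph.Reachable.refl, if_true, if_neg hb]
          ring
        · simp only [SimpleGraph.Reachable.refl, if_true, if_neg hb, hw b a]
          ring
    · push Not at he
      exact ⟨0, fun u v h => (he u v h).elim⟩

/-! ### Determinants of Coxeter transformations -/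

section Coxeter

open PowerSeries

variable {ι : Type*} [DecidableEq ι]

theorem simpleReflection_mul_apply [Fintype ι] (K C : Matrix ι ι ℤ) (a i j : ι) :
    (simpleReflection K a * C) i j = C i j - if i = a then ∑ k, K a k * C k j else 0 := by
  rw [simpleReflection, Matrix.sub_mul, Matrix.one_mul, Matrix.sub_apply, Matrix.mul_assoc]
  split_ifs with h
  · subst h
    rw [Matrix.single_mul_apply_same, one_mul, Matrix.mul_apply]
  · rw [Matrix.single_mul_apply_of_ne _ _ _ _ _ h]

/-- The rows of a product of distinct simple reflections. -/
theorem coxeterTransformation_apply [Fintype ι] (K : Matrix ι ι ℤ) (hK : ∀ i, K i i = 2) (p : ι → ℕ)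
    (l : List ι) (hl : l.Pairwise fun a b => p a < p b) (i j : ι) :
    coxeterTransformation K l i j = if i ∈ l then
      -(1 : Matrix ι ι ℤ) i j - ∑ k, (if k = i then 0 else if k ∈ l ∧ p i < p k then
        K i k * coxeterTransformation K l k j else K i k * (1 : Matrix ι ι ℤ) k j)
      else (1 : Matrix ι ι ℤ) i j := by
  induction l generalizing i with
  | nil => simp [coxeterTransformation]
  | cons a t ih =>
    rw [List.pairwise_cons] at hl
    obtain ⟨ha, ht⟩ := hl
    have hat : a ∉ t := fun h => (ha a h).false
    -- The leftmost reflection changes row `a` only. It reads the rows of the tail, which are final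
    -- for the later vertices and still rows of the identity for all others.
    have hrow : ∀ i, coxeterTransformation K (a :: t) i j = coxeterTransformation K t i j -
        if i = a then ∑ k, K a k * coxeterTransformation K t k j else 0 := fun i => by
      rw [← simpleReflection_mul_apply]; rfl
    by_cases hia : i = a
    · subst hia
      rw [hrow, ih ht i, if_neg hat, if_pos rfl, if_pos List.mem_cons_self,
        ← Finset.add_sum_erase _ _ (Finset.mem_univ i), ih ht i, if_neg hat, hK,
        ← Finset.add_sum_erase _ _ (Finset.mem_univ i), if_pos rfl]
      have : ∀ k ∈ Finset.univ.erase i, (if k = i then 0 else if k ∈ i :: t ∧ p i < p k then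
        K i k * coxeterTransformation K (i :: t) k j else K i k * (1 : Matrix ι ι ℤ) k j) =
          K i k * coxeterTransformation K t k j := by
        intro k hk
        have hki : k ≠ i := Finset.ne_of_mem_erase hk
        rw [if_neg hki, hrow, if_neg hki, sub_zero]
        by_cases hkt : k ∈ t
        · rw [if_pos ⟨List.mem_cons_of_mem _ hkt, ha k hkt⟩]
        · rw [if_neg (by simp [hki, hkt]), ih ht k, if_neg hkt]
      rw [Finset.sum_congr rfl this]
      ring
    · rw [hrow, if_neg hia, sub_zero, ih ht i]
      simp only [List.mem_cons, hia, false_or]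
      by_cases hit : i ∈ t
      · rw [if_pos hit, if_pos hit]
        congr 1
        refine Finset.sum_congr rfl fun k _ => ?_
        by_cases hka : k = a
        · subst hka
          have := ha i hit
          simp [hat, this.not_gt]
        · rw [hrow]
          simp [hka]
      · rw [if_neg hit, if_neg hit]

/-- The matrix `(1 + t ^ 2) I - t B` for `K = 2 I - B`. -/
noncomputable def coxeterPencil (K : Matrix ι ι ℤ) : Matrix ι ι (PowerSeries ℂ) :=
  Matrix.of fun i j => if i = j then 1 + X ^ 2 else X * (K i j : PowerSeries ℂ)

theorem IsVertexOrder.pairwise_idxOf {l : List ι} (hl : IsVertexOrder l) :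
    l.Pairwise fun a b => l.idxOf a < l.idxOf b := by
  rw [List.pairwise_iff_getElem]
  intro i j hi hj hij
  rwa [hl.1.idxOf_getElem, hl.1.idxOf_getElem]

theorem IsVertexOrder.idxOf_injective {l : List ι} (hl : IsVertexOrder l) :
    Function.Injective fun a => l.idxOf a :=
  fun a _ h => (List.idxOf_inj (hl.2 a)).1 h

/-- Heights along a Coxeter order: they drop by one along every edge of the diagram. -/
theorem IsCoxeterOrder.exists_height [Fintype ι] {K : Matrix ι ι ℤ} {l : List ι} (hl : IsCoxeterOrder K l) :
    ∃ h : ι → ℕ, ∀ i j, (diagram K).Adj i j → l.idxOf i < l.idxOf j → h i = h j + 1 := by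
  obtain ⟨hv, hac | ⟨-, l₁, l₂, rfl, h₁, h₂⟩⟩ := hl
  · obtain ⟨h, hh⟩ := hac.exists_potential
      (fun u v => if l.idxOf u < l.idxOf v then 1 else if l.idxOf v < l.idxOf u then -1 else 0)
      (fun u v => by split_ifs <;> omega)
    -- Heights become exponents of t, so the integral potential is shifted to be nonnegative.
    obtain ⟨c, hc⟩ := (Set.finite_range h).bddBelow
    refine ⟨fun i => (h i - c).toNat, fun i j hij hlt => ?_⟩
    have := hh i j hij
    rw [if_pos hlt] at this
    have h1 : c ≤ h i := hc ⟨i, rfl⟩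
    have h2 : c ≤ h j := hc ⟨j, rfl⟩
    change (h i - c).toNat = (h j - c).toNat + 1
    omega
  · refine ⟨fun i => if i ∈ l₁ then 1 else 0, fun i j hij hlt => ?_⟩
    have hi := List.mem_append.1 (hv.2 i)
    have hj := List.mem_append.1 (hv.2 j)
    by_cases hi1 : i ∈ l₁
    · have hj1 : j ∉ l₁ := fun hj1 => h₁ i hi1 j hj1 hij
      simp [hi1, hj1]
    · by_cases hj1 : j ∈ l₁
      · rw [List.idxOf_append_of_mem hj1, List.idxOf_append_of_notMem hi1] at hlt
        have := List.idxOf_lt_length_iff.2 hj1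
        omega
      · exact (h₂ i (hi.resolve_left hi1) j (hj.resolve_left hj1) hij).elim

theorem det_eq_one_of_unitriangular [Fintype ι] {R : Type*} [CommRing R] (M : Matrix ι ι R) (p : ι → ℕ)
    (hp : Function.Injective p) (hd : ∀ i, M i i = 1) (hM : ∀ i j, p j < p i → M i j = 0) :
    M.det = 1 := by
  let _ : LinearOrder ι := LinearOrder.lift' p hp
  have h : M.BlockTriangular id := fun i j hij => hM i j hij
  convert Matrix.det_of_isUpperTriangular h
  simp [hd]

/-- The characteristic polynomial at `t ^ 2` of a Coxeter transformation of `2 I - B` is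
`det ((1 + t ^ 2) I - t B)`. -/
theorem IsCoxeterOrder.detSq_eq [Fintype ι] {K : Matrix ι ι ℤ} (hK : ∀ i, K i i = 2) {l : List ι}
    (hl : IsCoxeterOrder K l) :
    detSq (coxeterTransformation K l) = (coxeterPencil K).det := by
  obtain ⟨h, hh⟩ := hl.exists_height
  set p : ι → ℕ := fun i => l.idxOf i with hp
  have hinj : Function.Injective p := hl.1.idxOf_injective
  set C := coxeterTransformation K l with hC
  have hrow := coxeterTransformation_apply K hK p l hl.1.pairwise_idxOf
  -- `N` is the unipotent upper part of K in the given order. The row formula says N C = −N' for the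
  -- lower part N', whence N(t² − C) = t²N + N' = `W`.
  let N : Matrix ι ι (PowerSeries ℂ) := Matrix.of fun i j =>
    if i = j then 1 else if p i < p j then (K i j : PowerSeries ℂ) else 0
  let W : Matrix ι ι (PowerSeries ℂ) := Matrix.of fun i j =>
    if i = j then 1 + X ^ 2 else if p i < p j then X ^ 2 * (K i j : PowerSeries ℂ) else
      (K i j : PowerSeries ℂ)
  have hN : N.det = 1 := det_eq_one_of_unitriangular N p hinj (by simp [N]) (fun i j hij => by
    have : i ≠ j := by rintro rfl; exact hij.false
    simp [N, this, hij.not_gt])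
  have hNW : N * ((PowerSeries.X ^ 2 : PowerSeries ℂ) • (1 : Matrix ι ι (PowerSeries ℂ)) -
      C.map fun a => ((a : ℤ) : PowerSeries ℂ)) = W := by
    ext1 i j
    have h1 : (C i j : PowerSeries ℂ) = _ := congrArg (Int.cast) (hrow i j)
    rw [if_pos (hl.1.2 i)] at h1
    have h2 : (N * C.map fun a => ((a : ℤ) : PowerSeries ℂ)) i j = C i j +
        ∑ k, ((if k = i then 0 else if p i < p k then K i k * C k j else 0 : ℤ) :
          PowerSeries ℂ) := by
      rw [Matrix.mul_apply, ← Finset.add_sum_erase _ _ (Finset.mem_univ i),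
        ← Finset.add_sum_erase (a := i) (f := fun k =>
          ((if k = i then 0 else if p i < p k then K i k * C k j else 0 : ℤ) : PowerSeries ℂ))
          _ (Finset.mem_univ i)]
      simp only [N, Matrix.of_apply, if_true, Matrix.map_apply, one_mul, Int.cast_zero, zero_add]
      congr 1
      refine Finset.sum_congr rfl fun k hk => ?_
      have hki : k ≠ i := Finset.ne_of_mem_erase hk
      rw [if_neg hki.symm, if_neg hki]
      split_ifs <;> simp
    rw [Matrix.mul_sub, Matrix.sub_apply, h2, h1, Matrix.mul_smul, Matrix.smul_apply,
      Matrix.mul_one]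
    -- Earlier vertices `k` contribute entries of the identity matrix, so their sum collapses to `K
    -- i j`, present only when `j` precedes `i`.
    have h3 : (∑ k, (if k = i then 0 else if k ∈ l ∧ p i < p k then
        K i k * C k j else K i k * (1 : Matrix ι ι ℤ) k j)) =
        (∑ k, (if k = i then 0 else if p i < p k then K i k * C k j else 0)) +
          if j = i then 0 else if p i < p j then 0 else K i j := by
      rw [show (if j = i then (0 : ℤ) else if p i < p j then 0 else K i j) = ∑ k, if k = j then
        (if k = i then (0 : ℤ) else if p i < p k then 0 else K i k) else 0 by simp,
        ← Finset.sum_add_distrib]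
      refine Finset.sum_congr rfl fun k _ => ?_
      by_cases hki : k = i
      · simp [hki]
      · simp only [hki, if_false, hl.1.2 k, true_and]
        by_cases hpk : p i < p k
        · simp [hpk]
        · simp [hpk, Matrix.one_apply]
    rw [h3]
    push_cast
    by_cases hij : i = j
    · subst hij
      simp [N, W]
      ring
    · simp only [N, W, Matrix.of_apply, if_neg hij, if_neg (Ne.symm hij), Matrix.one_apply_ne hij]
      split_ifs <;> simp
  -- The height difference ±1 along an edge turns the entry t²K above the diagonal, and the entry K
  -- below it, into tK.
  have hDW : Matrix.diagonal (fun i => (X : PowerSeries ℂ) ^ h i) * coxeterPencil K =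
      W * Matrix.diagonal (fun i => (X : PowerSeries ℂ) ^ h i) := by
    ext1 i j
    rw [Matrix.diagonal_mul, Matrix.mul_diagonal]
    by_cases hij : i = j
    · subst hij
      simp [coxeterPencil, W, mul_comm]
    · simp only [coxeterPencil, W, Matrix.of_apply, if_neg hij]
      by_cases hk : K i j = 0
      · simp [hk]
      · have hadj : (diagram K).Adj i j := ⟨hij, Or.inl hk⟩
        rcases lt_trichotomy (p i) (p j) with hlt | heq | hlt
        · rw [if_pos hlt, hh i j hadj hlt]
          ring
        · exact (hij (hinj heq)).elim
        · rw [if_neg hlt.not_gt, hh j i hadj.symm hlt]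
          ring
  -- The diagonal matrix is not invertible over ℂ⟦t⟧, but its determinant is a nonzero element of a
  -- domain and can be cancelled.
  have hdet : (Matrix.diagonal (fun i => (X : PowerSeries ℂ) ^ h i)).det ≠ 0 := by
    rw [Matrix.det_diagonal]
    exact Finset.prod_ne_zero_iff.2 fun i _ => pow_ne_zero _ X_ne_zero
  have h4 := congrArg Matrix.det hDW
  rw [Matrix.det_mul, Matrix.det_mul, mul_comm W.det] at h4
  rw [mul_left_cancel₀ hdet h4, ← hNW, Matrix.det_mul, hN, one_mul]
  rfl

/-- At t = 0 the pencil is the identity, so its determinant is a unit of ℂ⟦t⟧. This justifies the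
division in the final formula. -/
theorem constantCoeff_det_coxeterPencil [Fintype ι] (K : Matrix ι ι ℤ) :
    constantCoeff (coxeterPencil K).det = 1 := by
  rw [RingHom.map_det]
  rw [← Matrix.det_one (n := ι) (R := ℂ)]
  congr 1
  ext1 i j
  by_cases hij : i = j <;> simp [coxeterPencil, hij, Matrix.one_apply]

end Coxeter

/-- Cramer's rule for the entry `0` of the solution of `Mᵀ x = e₀`. -/
theorem det_mul_eq_det_submatrix_of_transpose_mulVec {R : Type*} [CommRing R] {r : ℕ}
    (M : Matrix (Fin (r + 1)) (Fin (r + 1)) R) (x : Fin (r + 1) → R)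
    (hx : Matrix.mulVec M.transpose x = Pi.single 0 1) :
    M.det * x 0 = (M.submatrix Fin.succ Fin.succ).det := by
  have h := congrArg (fun v => (Matrix.mulVec M.transpose.adjugate v) 0) hx
  simp only [Matrix.mulVec_mulVec, Matrix.adjugate_mul, Matrix.smul_mulVec, Matrix.one_mulVec,
    Matrix.det_transpose, Pi.smul_apply, smul_eq_mul, Matrix.mulVec_single_one,
    Matrix.col_apply] at h
  rw [h, Matrix.adjugate_fin_succ_eq_det_submatrix]
  simp only [Fin.succAbove_zero, Fin.val_zero, add_zero, pow_zero, one_mul]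
  rw [← Matrix.det_transpose]
  rfl

/-! ### Characters of symmetric powers -/

section SymPow

open MvPolynomial

/-- The operator on `Sym^n(ℂ²)` defined by a matrix. -/
noncomputable def symEnd (n : ℕ) :
    Matrix (Fin 2) (Fin 2) ℂ →* Module.End ℂ (homogeneousSubmodule (Fin 2) ℂ n) where
  toFun g := (linSubst g).toLinearMap.restrict fun p hp => linSubst_mem _ n p hp
  map_one' := by
    ext1 p
    apply Subtype.ext
    simp [linSubst_one]
  map_mul' g h := by
    ext1 p
    apply Subtype.ext
    change linSubst (g * h) _ = _
    rw [linSubst_mul]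
    rfl

/-- The exponent of the monomial `x₁ ^ a * x₂ ^ b`. -/
noncomputable def biExp (a b : ℕ) : Fin 2 →₀ ℕ := Finsupp.single 0 a + Finsupp.single 1 b

@[simp] theorem biExp_zero (a b : ℕ) : biExp a b 0 = a := by simp [biExp]

@[simp] theorem biExp_one (a b : ℕ) : biExp a b 1 = b := by simp [biExp]

theorem biExp_self (d : Fin 2 →₀ ℕ) : biExp (d 0) (d 1) = d := by
  ext i
  fin_cases i <;> simp

theorem degree_fin_two (d : Fin 2 →₀ ℕ) : d.degree = d 0 + d 1 := by
  rw [Finsupp.degree_eq_sum, Fin.sum_univ_two]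

/-- The coordinates of `Sym^n(ℂ²)` in the basis of monomials. -/
noncomputable def symCoord (n : ℕ) :
    homogeneousSubmodule (Fin 2) ℂ n ≃ₗ[ℂ] (Fin (n + 1) → ℂ) where
  toFun p k := coeff (biExp k (n - k)) (p : MvPolynomial (Fin 2) ℂ)
  map_add' p q := by ext; simp
  map_smul' c p := by ext; simp
  invFun f := ⟨∑ k : Fin (n + 1), monomial (biExp k (n - k)) (f k), Submodule.sum_mem _ fun k _ => by
    rw [mem_homogeneousSubmodule]
    apply isHomogeneous_monomial
    rw [degree_fin_two, biExp_zero, biExp_one]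
    have := k.2
    omega⟩
  left_inv p := by
    apply Subtype.ext
    ext d
    rw [coeff_sum]
    simp only [coeff_monomial]
    by_cases hd : d.degree = n
    · rw [degree_fin_two] at hd
      rw [Finset.sum_eq_single ⟨d 0, by omega⟩]
      · have : biExp (d 0) (n - d 0) = d := by
          rw [← hd, Nat.add_sub_cancel_left, biExp_self]
        simp [this]
      · intro k _ hk
        rw [if_neg]
        intro h
        apply hk
        ext
        simpa using DFunLike.congr_fun h 0
      · simp
    · rw [IsHomogeneous.coeff_eq_zero (mem_homogeneousSubmodule _ _ |>.1 p.2) hd]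
      refine Finset.sum_eq_zero fun k _ => if_neg ?_
      rintro rfl
      apply hd
      rw [degree_fin_two, biExp_zero, biExp_one]
      have := k.2
      omega
  right_inv f := by
    ext k
    simp only [coeff_sum, coeff_monomial]
    rw [Finset.sum_eq_single k]
    · simp
    · intro j _ hj
      rw [if_neg]
      intro h
      apply hj
      ext
      have := DFunLike.congr_fun h 0
      simpa using this
    · simp

instance (n : ℕ) : FiniteDimensional ℂ (homogeneousSubmodule (Fin 2) ℂ n) :=
  Module.Finite.equiv (symCoord n).symm

theorem coeff_linear_pow (a b : ℂ) (m : ℕ) :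
    coeff (Finsupp.single 1 m) ((C a * X 0 + C b * X 1 : MvPolynomial (Fin 2) ℂ) ^ m) = b ^ m := by
  induction m with
  | zero => simp
  | succ m ih =>
    rw [pow_succ', add_mul, coeff_add, mul_assoc, mul_assoc, coeff_C_mul, coeff_C_mul,
      coeff_X_mul', coeff_X_mul', if_neg (by simp), if_pos (by simp),
      Finsupp.single_add, add_tsub_cancel_right, ih]
    ring

/-- The substitution sends x₁ to a multiple of itself, so x₁^k x₂^(n−k) keeps its own coefficient
T₀₀^k T₁₁^(n−k). The trace is the complete homogeneous polynomial in the two eigenvalues. -/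
theorem trace_symEnd_of_triangular (n : ℕ) (T : Matrix (Fin 2) (Fin 2) ℂ) (hT : T 1 0 = 0) :
    LinearMap.trace ℂ _ (symEnd n T) = ∑ k ∈ Finset.range (n + 1), T 0 0 ^ k * T 1 1 ^ (n - k) := by
  rw [← LinearMap.trace_conj' _ (symCoord n),
    LinearMap.trace_eq_matrix_trace ℂ (Pi.basisFun ℂ (Fin (n + 1))), Matrix.trace,
    Finset.sum_range fun k => T 0 0 ^ k * T 1 1 ^ (n - k)]
  refine Finset.sum_congr rfl fun k _ => ?_
  rw [Matrix.diag_apply, LinearMap.toMatrix_apply]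
  simp only [Pi.basisFun_apply, Pi.basisFun_repr, LinearEquiv.conj_apply_apply]
  have h1 : ((symCoord n).symm (Pi.single k 1) : MvPolynomial (Fin 2) ℂ) =
      X 0 ^ (k : ℕ) * X 1 ^ (n - k) := by
    change ∑ j : Fin (n + 1), monomial (biExp j (n - j)) ((Pi.single k 1 : Fin (n + 1) → ℂ) j) = _
    rw [Finset.sum_eq_single k]
    · rw [Pi.single_eq_same, biExp, X_pow_eq_monomial, X_pow_eq_monomial, monomial_mul, one_mul]
    · intro j _ hj
      rw [Pi.single_eq_of_ne hj, map_zero]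
    · simp
  change coeff (biExp k (n - k)) (linSubst T ((symCoord n).symm (Pi.single k 1) :)) = _
  rw [h1, map_mul, map_pow, map_pow]
  have h2 : linSubst T (X 0) = C (T 0 0) * X 0 := by simp [linSubst, hT]
  have h3 : linSubst T (X 1) = C (T 0 1) * X 0 + C (T 1 1) * X 1 := by simp [linSubst]
  rw [h2, h3, mul_pow, mul_assoc, ← C_pow, coeff_C_mul, X_pow_eq_monomial, biExp,
    coeff_monomial_mul, coeff_linear_pow, one_mul]

/-- An eigenvector is completed to a basis by a standard vector. Since `symEnd` is multiplicative on
all matrices, `P` need not be unitary, and triangular form suffices for traces. -/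
theorem exists_triangularization (g : Matrix (Fin 2) (Fin 2) ℂ) :
    ∃ P Q T : Matrix (Fin 2) (Fin 2) ℂ, P * Q = 1 ∧ Q * P = 1 ∧ g = P * T * Q ∧ T 1 0 = 0 := by
  obtain ⟨c, hc⟩ := Module.End.exists_eigenvalue (Matrix.toLin' g)
  obtain ⟨v, hv⟩ := hc.exists_hasEigenvector
  have hgv : g.mulVec v = c • v := by simpa using hv.apply_eq_smul
  have hP : ∃ P : Matrix (Fin 2) (Fin 2) ℂ, IsUnit P.det ∧ ∀ i, P i 0 = v i := by
    by_cases h0 : v 0 = 0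
    · refine ⟨!![v 0, 1; v 1, 0], ?_, fun i => by fin_cases i <;> simp⟩
      have h1 : v 1 ≠ 0 := fun h1 => hv.2 (by ext i; fin_cases i <;> simp [h0, h1])
      simp [Matrix.det_fin_two, h1]
    · refine ⟨!![v 0, 0; v 1, 1], ?_, fun i => by fin_cases i <;> simp⟩
      simp [Matrix.det_fin_two, h0]
  obtain ⟨P, hu, hPv⟩ := hP
  refine ⟨P, P⁻¹, P⁻¹ * g * P, Matrix.mul_nonsing_inv _ hu, Matrix.nonsing_inv_mul _ hu, ?_, ?_⟩
  · simp only [← Matrix.mul_assoc]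
    rw [Matrix.mul_nonsing_inv _ hu, Matrix.one_mul, Matrix.mul_assoc, Matrix.mul_nonsing_inv _ hu,
      Matrix.mul_one]
  · have hcol : ∀ i, (g * P) i 0 = c * P i 0 := fun i => by
      have := congrFun hgv i
      simpa [Matrix.mul_apply, Matrix.mulVec, dotProduct, hPv] using this
    rw [Matrix.mul_assoc, Matrix.mul_apply]
    simp only [hcol]
    have h1 : (P⁻¹ * P) 1 0 = 0 := by rw [Matrix.nonsing_inv_mul _ hu]; simp
    rw [Matrix.mul_apply] at h1
    calc ∑ j, P⁻¹ 1 j * (c * P j 0) = c * ∑ j, P⁻¹ 1 j * P j 0 := by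
          rw [Finset.mul_sum]; exact Finset.sum_congr rfl fun j _ => by ring
      _ = 0 := by rw [h1, mul_zero]

/-- The Clebsch–Gordan recursion. -/
theorem trace_mul_trace_symEnd (n : ℕ) (g : Matrix (Fin 2) (Fin 2) ℂ) (hg : g.det = 1) :
    g.trace * LinearMap.trace ℂ _ (symEnd (n + 1) g) =
      LinearMap.trace ℂ _ (symEnd (n + 2) g) + LinearMap.trace ℂ _ (symEnd n g) := by
  obtain ⟨P, Q, T, hPQ, hQP, rfl, hT⟩ := exists_triangularization g
  have hconj : ∀ m, LinearMap.trace ℂ _ (symEnd m (P * T * Q)) =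
      LinearMap.trace ℂ _ (symEnd m T) := fun m => by
    rw [map_mul, LinearMap.trace_mul_comm, ← map_mul, ← Matrix.mul_assoc, hQP, Matrix.one_mul]
  have hdet : T 0 0 * T 1 1 = 1 := by
    rw [Matrix.det_mul, mul_comm, ← Matrix.det_mul, ← Matrix.mul_assoc, hQP, Matrix.one_mul,
      Matrix.det_fin_two, hT] at hg
    simpa using hg
  rw [hconj, hconj, hconj, trace_symEnd_of_triangular _ _ hT, trace_symEnd_of_triangular _ _ hT,
    trace_symEnd_of_triangular _ _ hT, Matrix.trace_mul_comm, ← Matrix.mul_assoc, hQP,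
    Matrix.one_mul, Matrix.trace_fin_two]
  -- For h_m = Σ a^k b^(m−k) one has h_{m+1} = b h_m + a^{m+1}. Used twice, this gives (a + b)
  -- h_{n+1} = h_{n+2} + ab h_n, and ab = det = 1.
  have h2 : ∑ k ∈ Finset.range (n + 2 + 1), T 0 0 ^ k * T 1 1 ^ (n + 2 - k) =
      T 1 1 * (∑ k ∈ Finset.range (n + 1 + 1), T 0 0 ^ k * T 1 1 ^ (n + 1 - k)) +
        T 0 0 ^ (n + 2) := by
    rw [Finset.sum_range_succ, Finset.mul_sum, Nat.sub_self, pow_zero, mul_one]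
    congr 1
    refine Finset.sum_congr rfl fun k hk => ?_
    have hk' : k ≤ n + 1 := by simpa [Nat.lt_succ_iff] using hk
    rw [show n + 2 - k = (n + 1 - k) + 1 by omega]
    ring
  have h1 : ∑ k ∈ Finset.range (n + 1 + 1), T 0 0 ^ k * T 1 1 ^ (n + 1 - k) =
      T 1 1 * (∑ k ∈ Finset.range (n + 1), T 0 0 ^ k * T 1 1 ^ (n - k)) + T 0 0 ^ (n + 1) := by
    rw [Finset.sum_range_succ, Finset.mul_sum, Nat.sub_self, pow_zero, mul_one]
    congr 1
    refine Finset.sum_congr rfl fun k hk => ?_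
    have hk' : k ≤ n := by simpa [Nat.lt_succ_iff] using hk
    rw [show n + 1 - k = (n - k) + 1 by omega]
    ring
  rw [h2, h1]
  linear_combination (∑ k ∈ Finset.range (n + 1), T 0 0 ^ k * T 1 1 ^ (n - k)) * hdet

theorem trace_symEnd_zero (g : Matrix (Fin 2) (Fin 2) ℂ) :
    LinearMap.trace ℂ _ (symEnd 0 g) = 1 := by
  obtain ⟨P, Q, T, hPQ, hQP, rfl, hT⟩ := exists_triangularization g
  rw [map_mul, LinearMap.trace_mul_comm, ← map_mul, ← Matrix.mul_assoc, hQP, Matrix.one_mul,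
    trace_symEnd_of_triangular _ _ hT]
  simp

theorem trace_symEnd_one (g : Matrix (Fin 2) (Fin 2) ℂ) :
    LinearMap.trace ℂ _ (symEnd 1 g) = g.trace := by
  obtain ⟨P, Q, T, hPQ, hQP, rfl, hT⟩ := exists_triangularization g
  rw [map_mul, LinearMap.trace_mul_comm, ← map_mul, ← Matrix.mul_assoc, hQP, Matrix.one_mul,
    trace_symEnd_of_triangular _ _ hT, Matrix.trace_mul_comm, ← Matrix.mul_assoc, hQP,
    Matrix.one_mul, Matrix.trace_fin_two]
  simp [Finset.sum_range_succ, add_comm]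

variable {Γ : Type*} [Group Γ] (φ : Γ →* SU2)

theorem SU2.det_eq_one (g : SU2) : (g : Matrix (Fin 2) (Fin 2) ℂ).det = 1 :=
  (Matrix.mem_specialUnitaryGroup_iff.1 g.2).2

theorem stdChar_mul_character_symPow (n : ℕ) (γ : Γ) :
    stdChar φ γ * Representation.character ((symPow (n + 1)).comp φ) γ =
      Representation.character ((symPow (n + 2)).comp φ) γ +
        Representation.character ((symPow n).comp φ) γ :=
  trace_mul_trace_symEnd n _ (SU2.det_eq_one _)

theorem character_symPow_zero (γ : Γ) :
    Representation.character ((symPow 0).comp φ) γ = 1 := trace_symEnd_zero _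

theorem character_symPow_one (γ : Γ) :
    Representation.character ((symPow 1).comp φ) γ = stdChar φ γ := trace_symEnd_one _

theorem finrank_invariants_symPow (n : ℕ) :
    Module.finrank ℂ (Representation.invariants ((symPow n).comp φ)) = Module.finrank ℂ
      ↥(homogeneousSubmodule (Fin 2) ℂ n ⊓ Subalgebra.toSubmodule (invariantAlgebra φ)) := by
  rw [← Submodule.map_comap_subtype,
    ← (Submodule.equivMapOfInjective _ (Submodule.injective_subtype _) _).finrank_eq]
  have h : Representation.invariants ((symPow n).comp φ) =
      Submodule.comap (homogeneousSubmodule (Fin 2) ℂ n).subtype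
        (Subalgebra.toSubmodule (invariantAlgebra φ)) := by
    ext p
    exact forall_congr' fun γ => Subtype.ext_iff
  rw [h]

end SymPow

/-! ### Elements of `SU(2)` -/

theorem SU2.coe_inv (g : SU2) : ((g⁻¹ : SU2) : Matrix (Fin 2) (Fin 2) ℂ) =
    (g : Matrix (Fin 2) (Fin 2) ℂ).adjugate := by
  have h : ((g⁻¹ : SU2) : Matrix (Fin 2) (Fin 2) ℂ) * (g : Matrix (Fin 2) (Fin 2) ℂ) = 1 :=
    congrArg Subtype.val (inv_mul_cancel g)
  calc ((g⁻¹ : SU2) : Matrix (Fin 2) (Fin 2) ℂ)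
      = (g⁻¹ : SU2) * ((g : Matrix (Fin 2) (Fin 2) ℂ) *
        (g : Matrix (Fin 2) (Fin 2) ℂ).adjugate) := by
        rw [Matrix.mul_adjugate, SU2.det_eq_one, one_smul, Matrix.mul_one]
    _ = _ := by rw [← Matrix.mul_assoc, h, Matrix.one_mul]

theorem SU2.coe_inv_eq_star (g : SU2) : ((g⁻¹ : SU2) : Matrix (Fin 2) (Fin 2) ℂ) =
    star (g : Matrix (Fin 2) (Fin 2) ℂ) := rfl

theorem SU2.trace_inv (g : SU2) : ((g⁻¹ : SU2) : Matrix (Fin 2) (Fin 2) ℂ).trace =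
    (g : Matrix (Fin 2) (Fin 2) ℂ).trace := by
  rw [SU2.coe_inv, Matrix.adjugate_fin_two, Matrix.trace_fin_two, Matrix.trace_fin_two]
  simp [add_comm]

/-- Comparing adjoint and adjugate shows that the diagonal entries are conjugate, so M₀₀ has real
part 1. The first column has norm 1, which leaves no room for anything else. -/
theorem SU2.eq_one_of_trace (g : SU2) (hg : (g : Matrix (Fin 2) (Fin 2) ℂ).trace = 2) :
    g = 1 := by
  have h := (SU2.coe_inv_eq_star g).symm.trans (SU2.coe_inv g)
  have hdet := SU2.det_eq_one g
  rw [Matrix.adjugate_fin_two] at h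
  rw [Matrix.det_fin_two] at hdet
  rw [Matrix.trace_fin_two] at hg
  set M := (g : Matrix (Fin 2) (Fin 2) ℂ) with hM
  have h00 : conj (M 0 0) = M 1 1 := by simpa using congrFun (congrFun h 0) 0
  have h01 : conj (M 1 0) = -M 0 1 := by simpa using congrFun (congrFun h 0) 1
  have hre : (M 0 0).re = 1 := by
    rw [← h00, Complex.add_conj] at hg
    have := congrArg Complex.re hg
    simp at this
    exact this
  have hn : Complex.normSq (M 0 0) + Complex.normSq (M 1 0) = 1 := by
    have : (M 0 0 * conj (M 0 0) + M 1 0 * conj (M 1 0) : ℂ) = 1 := by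
      rw [h00, h01, ← hdet]; ring
    rw [Complex.mul_conj, Complex.mul_conj] at this
    exact_mod_cast this
  have hsq : Complex.normSq (M 0 0) = 1 + (M 0 0).im ^ 2 := by
    rw [Complex.normSq_apply, hre]; ring
  have h1 := Complex.normSq_nonneg (M 1 0)
  have him : (M 0 0).im = 0 := by nlinarith
  have h10 : M 1 0 = 0 := Complex.normSq_eq_zero.1 (by nlinarith)
  have e00 : M 0 0 = 1 := Complex.ext hre him
  have e01 : M 0 1 = 0 := by rw [h10] at h01; simpa using h01.symm
  have e11 : M 1 1 = 1 := by rw [← h00, e00]; simp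
  apply Subtype.ext
  change M = 1
  ext i j
  fin_cases i <;> fin_cases j <;> simp [e00, h10, e01, e11]

/-- A matrix of determinant 1 that is its own inverse equals its adjugate, hence is a scalar with
square 1. -/
theorem SU2.coe_eq_neg_one_of_sq (g : SU2) (h2 : g ^ 2 = 1) (h1 : g ≠ 1) :
    (g : Matrix (Fin 2) (Fin 2) ℂ) = -1 := by
  have hinv : g⁻¹ = g := inv_eq_of_mul_eq_one_left (by rw [← sq, h2])
  have h := SU2.coe_inv g
  rw [hinv, Matrix.adjugate_fin_two] at h
  have hdet := SU2.det_eq_one g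
  rw [Matrix.det_fin_two] at hdet
  have htr : (g : Matrix (Fin 2) (Fin 2) ℂ).trace ≠ 2 := fun ht => h1 (SU2.eq_one_of_trace g ht)
  rw [Matrix.trace_fin_two] at htr
  set M := (g : Matrix (Fin 2) (Fin 2) ℂ) with hM
  have e00 : M 0 0 = M 1 1 := by simpa using congrFun (congrFun h 0) 0
  have e01 : M 0 1 = -M 0 1 := by simpa using congrFun (congrFun h 0) 1
  have e10 : M 1 0 = -M 1 0 := by simpa using congrFun (congrFun h 1) 0
  have f01 : M 0 1 = 0 := self_eq_neg.1 e01
  have f10 : M 1 0 = 0 := self_eq_neg.1 e10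
  rw [f01, ← e00, zero_mul, sub_zero] at hdet
  have f00 : M 0 0 = -1 := by
    rcases mul_self_eq_one_iff.1 hdet with h | h
    · rw [← e00, h] at htr
      norm_num at htr
    · exact h
  ext i j
  fin_cases i <;> fin_cases j <;> simp [f00, f01, f10, ← e00]

section StdChar

variable {Γ : Type*} [Group Γ] (φ : Γ →* SU2)

theorem stdChar_inv (γ : Γ) : stdChar φ γ⁻¹ = stdChar φ γ := by
  rw [stdChar, map_inv, SU2.trace_inv, stdChar]

theorem stdChar_one : stdChar φ 1 = 2 := by
  simp [stdChar]

theorem eq_one_of_stdChar_eq_two (hφ : Function.Injective φ) (γ : Γ) (h : stdChar φ γ = 2) :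
    γ = 1 :=
  hφ ((SU2.eq_one_of_trace _ h).trans (map_one φ).symm)

theorem stdChar_mul_of_coe_eq_neg_one {z : Γ}
    (hz : (φ z : Matrix (Fin 2) (Fin 2) ℂ) = -1) (γ : Γ) :
    stdChar φ (z * γ) = -stdChar φ γ := by
  rw [stdChar, map_mul]
  change ((φ z : Matrix (Fin 2) (Fin 2) ℂ) * (φ γ : Matrix (Fin 2) (Fin 2) ℂ)).trace = _
  rw [hz, neg_one_mul, Matrix.trace_neg]
  rfl

/-- Cauchy's theorem supplies an involution, and −1 is the only involution of SU(2). -/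
theorem exists_coe_eq_neg_one [Finite Γ] (hφ : Function.Injective φ) (h : Even (Nat.card Γ)) :
    ∃ z : Γ, (φ z : Matrix (Fin 2) (Fin 2) ℂ) = -1 := by
  obtain ⟨z, hz⟩ := exists_prime_orderOf_dvd_card' 2 h.two_dvd
  refine ⟨z, SU2.coe_eq_neg_one_of_sq _ ?_ fun h1 => ?_⟩
  · rw [← map_pow, show z ^ 2 = 1 from hz ▸ pow_orderOf_eq_one z, map_one]
  · rw [hφ (h1.trans (map_one φ).symm), orderOf_one] at hz
    omega

theorem sq_eq_one_of_coe_eq_neg_one (hφ : Function.Injective φ) {z : Γ}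
    (hz : (φ z : Matrix (Fin 2) (Fin 2) ℂ) = -1) : z * z = 1 := by
  apply hφ
  apply Subtype.ext
  rw [map_mul, map_one]
  change (φ z : Matrix (Fin 2) (Fin 2) ℂ) * (φ z : Matrix (Fin 2) (Fin 2) ℂ) = 1
  simp [hz]

theorem commute_of_coe_eq_neg_one (hφ : Function.Injective φ) {z : Γ}
    (hz : (φ z : Matrix (Fin 2) (Fin 2) ℂ) = -1) (γ : Γ) : z * γ = γ * z := by
  apply hφ
  apply Subtype.ext
  rw [map_mul, map_mul]
  change (φ z : Matrix (Fin 2) (Fin 2) ℂ) * (φ γ : Matrix (Fin 2) (Fin 2) ℂ) =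
    (φ γ : Matrix (Fin 2) (Fin 2) ℂ) * (φ z : Matrix (Fin 2) (Fin 2) ℂ)
  simp [hz]

theorem stdChar_conj (x γ : Γ) : stdChar φ (x * γ * x⁻¹) = stdChar φ γ := by
  simp only [← character_symPow_one]
  exact Representation.char_conj _ _ _

end StdChar

/-! ### Orthogonal families of class functions and their tensor matrices -/

section Pairing

variable {Γ : Type*} [Group Γ] [Fintype Γ]

/-- The bilinear form `|Γ|⁻¹ ∑ g, α g * β g⁻¹`. -/
noncomputable def charPair (α β : Γ → ℂ) : ℂ :=
  (Fintype.card Γ : ℂ)⁻¹ * ∑ g, α g * β g⁻¹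

theorem charPair_comm (α β : Γ → ℂ) : charPair α β = charPair β α := by
  rw [charPair, charPair, ← Equiv.sum_comp (Equiv.inv Γ)]
  simp [mul_comm]

theorem charPair_sum_left {ι : Type*} (s : Finset ι) (c : ι → ℂ) (α : ι → Γ → ℂ) (β : Γ → ℂ) :
    charPair (fun g => ∑ i ∈ s, c i * α i g) β = ∑ i ∈ s, c i * charPair (α i) β := by
  simp only [charPair, Finset.sum_mul, Finset.mul_sum]
  rw [Finset.sum_comm]
  exact Finset.sum_congr rfl fun i _ => Finset.sum_congr rfl fun g _ => by ring

theorem charPair_add_left (α α' β : Γ → ℂ) :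
    charPair (fun g => α g + α' g) β = charPair α β + charPair α' β := by
  simp only [charPair, add_mul, Finset.sum_add_distrib, mul_add]

/-- Multiplication by the character of ρ is self-adjoint because traces in SU(2) are invariant under
inversion. -/
theorem charPair_stdChar (φ : Γ →* SU2) (α β : Γ → ℂ) :
    charPair (fun g => stdChar φ g * α g) β = charPair α (fun g => stdChar φ g * β g) := by
  simp only [charPair, stdChar_inv]
  congr 1
  exact Finset.sum_congr rfl fun g _ => by ring

/-- The bilinear pairing carries all the computations. Complex conjugation has to be compared with
inversion only for the second argument `χ 0` of the final series. -/
theorem charInner_eq_charPair (α β : Γ → ℂ) (hβ : ∀ g, conj (β g) = β g⁻¹) :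
    charInner α β = charPair α β := by
  simp only [charInner, charPair, hβ]

end Pairing

/-- An orthogonal family of class functions that behaves like the irreducible characters of a
group `Γ` of even order in `SU(2)`. -/
structure IsMcKayFamily {Γ : Type*} [Group Γ] [Fintype Γ] (φ : Γ →* SU2) {r : ℕ}
    (χ : Fin (r + 1) → Γ → ℂ) : Prop where
  injective : Function.Injective φ
  orthogonal : ∀ i j, i ≠ j → charPair (χ i) (χ j) = 0
  norm : ∃ N : ℕ, N ≠ 0 ∧ ∀ i, ∃ a : ℕ, 0 < a ∧ N * charPair (χ i) (χ i) = a
  degree : ∀ i, ∃ d : ℕ, 0 < d ∧ χ i 1 = d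
  parity : ∃ z : Γ, (φ z : Matrix (Fin 2) (Fin 2) ℂ) = -1 ∧
    ∀ i, (∀ g, χ i (z * g) = χ i g) ∨ (∀ g, χ i (z * g) = -χ i g)
  pair_one : ∀ i, charPair 1 (χ i) = if i = 0 then 1 else 0
  conj_zero : ∀ g, conj (χ 0 g) = χ 0 g⁻¹

theorem exists_isTensorMatrix_of_mem_closure {Γ : Type*} [Group Γ] (φ : Γ →* SU2) {r : ℕ}
    (χ : Fin (r + 1) → Γ → ℂ)
    (h : ∀ i, (fun g => stdChar φ g * χ i g) ∈ AddSubmonoid.closure (Set.range χ)) :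
    ∃ A, IsTensorMatrix φ χ A := by
  have h' : ∀ i, ∃ a : Fin (r + 1) → ℕ, (fun g => stdChar φ g * χ i g) = ∑ j, a j • χ j := by
    intro i
    have hi := h i
    rw [← Submodule.span_nat_eq_addSubmonoidClosure, Submodule.mem_toAddSubmonoid,
      Submodule.mem_span_range_iff_exists_fun] at hi
    obtain ⟨c, hc⟩ := hi
    exact ⟨c, hc.symm⟩
  choose a ha using h'
  refine ⟨Matrix.of a, fun i g => ?_⟩
  have := congrFun (ha i) g
  simpa [Finset.sum_apply] using this

namespace IsMcKayFamily

variable {Γ : Type*} [Group Γ] [Fintype Γ] {φ : Γ →* SU2} {r : ℕ} {χ : Fin (r + 1) → Γ → ℂ}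

theorem pair_self_ne_zero (hχ : IsMcKayFamily φ χ) (i : Fin (r + 1)) :
    charPair (χ i) (χ i) ≠ 0 := by
  obtain ⟨N, -, h⟩ := hχ.norm
  obtain ⟨a, ha, h⟩ := h i
  intro h0
  rw [h0, mul_zero] at h
  exact ha.ne (by exact_mod_cast h)

theorem pair_sum (hχ : IsMcKayFamily φ χ) (s : Finset (Fin (r + 1))) (c : Fin (r + 1) → ℂ)
    (j : Fin (r + 1)) : charPair (fun g => ∑ i ∈ s, c i * χ i g) (χ j) =
      if j ∈ s then c j * charPair (χ j) (χ j) else 0 := by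
  rw [charPair_sum_left]
  split_ifs with hj
  · exact Finset.sum_eq_single_of_mem j hj fun i _ hij => by rw [hχ.orthogonal i j hij, mul_zero]
  · exact Finset.sum_eq_zero fun i hi => by
      rw [hχ.orthogonal i j (by rintro rfl; exact hj hi), mul_zero]

theorem pair_stdChar (hχ : IsMcKayFamily φ χ) {A : Matrix (Fin (r + 1)) (Fin (r + 1)) ℕ}
    (hA : IsTensorMatrix φ χ A) (i j : Fin (r + 1)) :
    charPair (fun g => stdChar φ g * χ i g) (χ j) = A i j * charPair (χ j) (χ j) := by
  have : (fun g => stdChar φ g * χ i g) = fun g => ∑ k, (A i k : ℂ) * χ k g := funext (hA i)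
  rw [this, hχ.pair_sum, if_pos (Finset.mem_univ j)]

theorem tensorMatrix_unique (hχ : IsMcKayFamily φ χ)
    {A A' : Matrix (Fin (r + 1)) (Fin (r + 1)) ℕ}
    (hA : IsTensorMatrix φ χ A) (hA' : IsTensorMatrix φ χ A') : A = A' := by
  ext i j
  have h := (hχ.pair_stdChar hA i j).symm.trans (hχ.pair_stdChar hA' i j)
  exact_mod_cast mul_right_cancel₀ (hχ.pair_self_ne_zero j) h

/-- Both sides equal ⟨ρ χ_i, χ_j⟩, so the norms symmetrize the matrix. -/
theorem symmetrizable (hχ : IsMcKayFamily φ χ) {A : Matrix (Fin (r + 1)) (Fin (r + 1)) ℕ}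
    (hA : IsTensorMatrix φ χ A) (i j : Fin (r + 1)) :
    A i j * charPair (χ j) (χ j) = A j i * charPair (χ i) (χ i) := by
  rw [← hχ.pair_stdChar hA, ← hχ.pair_stdChar hA, charPair_stdChar, charPair_comm]

/-- Substituting zg for g changes the sign of ρ, while the factors ε of χ_i and χ_j cancel. Hence ⟨ρ
χ_i, χ_j⟩ equals its own negative. -/
theorem eq_zero_of_parity (hχ : IsMcKayFamily φ χ) {A : Matrix (Fin (r + 1)) (Fin (r + 1)) ℕ}
    (hA : IsTensorMatrix φ χ A) {z : Γ} (hz : (φ z : Matrix (Fin 2) (Fin 2) ℂ) = -1)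
    {ε : ℂ} (hε : ε * ε = 1) {i j : Fin (r + 1)} (hi : ∀ g, χ i (z * g) = ε * χ i g)
    (hj : ∀ g, χ j (z * g) = ε * χ j g) : A i j = 0 := by
  have h1 : charPair (fun g => stdChar φ g * χ i g) (χ j) = 0 := by
    rw [← CharZero.eq_neg_self_iff, charPair, ← mul_neg, ← Finset.sum_neg_distrib]
    congr 1
    rw [← Equiv.sum_comp (Equiv.mulLeft z)]
    refine Finset.sum_congr rfl fun g _ => ?_
    have hzinv : z⁻¹ = z :=
      inv_eq_of_mul_eq_one_left (sq_eq_one_of_coe_eq_neg_one φ hχ.injective hz)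
    rw [Equiv.coe_mulLeft, stdChar_mul_of_coe_eq_neg_one φ hz, hi, mul_inv_rev, hzinv,
      ← commute_of_coe_eq_neg_one φ hχ.injective hz, hj]
    linear_combination (-(stdChar φ g * χ i g * χ j g⁻¹)) * hε
  rw [hχ.pair_stdChar hA] at h1
  exact_mod_cast (mul_eq_zero.1 h1).resolve_right (hχ.pair_self_ne_zero j)

/-- The color records the sign by which −1 acts. Taking i = j also excludes loops, so the diagonal
of the matrix vanishes. -/
theorem exists_coloring (hχ : IsMcKayFamily φ χ) {A : Matrix (Fin (r + 1)) (Fin (r + 1)) ℕ}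
    (hA : IsTensorMatrix φ χ A) : ∃ c : Fin (r + 1) → Bool, ∀ i j, c i = c j → A i j = 0 := by
  classical
  obtain ⟨z, hz, hpar⟩ := hχ.parity
  refine ⟨fun i => decide (∀ g, χ i (z * g) = χ i g), fun i j hij => ?_⟩
  rw [decide_eq_decide] at hij
  by_cases hi : ∀ g, χ i (z * g) = χ i g
  · exact hχ.eq_zero_of_parity hA hz (mul_one 1) (by simpa using hi) (by simpa using hij.1 hi)
  · have hj := (hpar j).resolve_left fun h => hi (hij.2 h)
    exact hχ.eq_zero_of_parity hA hz (ε := -1) (by norm_num)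
      (by simpa using (hpar i).resolve_left hi) (by simpa using hj)

/-- The positive integer null vector of `2 I - B`, together with the relation it satisfies. -/
theorem exists_null_vector (hχ : IsMcKayFamily φ χ) {A : Matrix (Fin (r + 1)) (Fin (r + 1)) ℕ}
    (hA : IsTensorMatrix φ χ A) : ∃ δ : Fin (r + 1) → ℕ, (∀ i, 0 < δ i) ∧
      ∀ j, ∑ i, A i j * δ i = 2 * δ j := by
  obtain ⟨N, hN, hnorm⟩ := hχ.norm
  choose a ha hNa using hnorm
  choose d hd hχd using hχ.degree
  have hdA : ∀ i, ∑ j, A i j * d j = 2 * d i := fun i => by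
    have := hA i 1
    rw [stdChar_one] at this
    simp only [hχd] at this
    exact_mod_cast this.symm
  have hsymm : ∀ i j, A i j * a j = A j i * a i := fun i j => by
    have := congrArg (fun x => (N : ℂ) * x) (hχ.symmetrizable hA i j)
    simp only [mul_left_comm (N : ℂ), hNa] at this
    exact_mod_cast this
  -- At g = 1 the tensor formula gives A d = 2d. Symmetrizability makes d_i / a_i an eigenvector of
  -- the transpose for the same eigenvalue, and multiplying by ∏ a_k clears denominators.
  refine ⟨fun i => d i * ∏ k ∈ Finset.univ.erase i, a k, fun i =>
    Nat.mul_pos (hd i) (Finset.prod_pos fun k _ => ha k), fun j => ?_⟩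
  have hprod : ∀ i, a i * ∏ k ∈ Finset.univ.erase i, a k = ∏ k, a k := fun i =>
    Finset.mul_prod_erase _ _ (Finset.mem_univ i)
  have hw : ∀ i, A i j * (∏ k ∈ Finset.univ.erase i, a k) =
      A j i * ∏ k ∈ Finset.univ.erase j, a k := fun i => by
    apply Nat.eq_of_mul_eq_mul_left (Nat.mul_pos (ha i) (ha j))
    calc a i * a j * (A i j * ∏ k ∈ Finset.univ.erase i, a k)
        = A i j * a j * (a i * ∏ k ∈ Finset.univ.erase i, a k) := by ring
      _ = A j i * a i * (a j * ∏ k ∈ Finset.univ.erase j, a k) := by rw [hprod, hprod, hsymm]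
      _ = _ := by ring
  calc ∑ i, A i j * (d i * ∏ k ∈ Finset.univ.erase i, a k)
      = ∑ i, (A j i * d i) * ∏ k ∈ Finset.univ.erase j, a k :=
        Finset.sum_congr rfl fun i _ => by rw [mul_left_comm, hw]; ring
    _ = 2 * (d j * ∏ k ∈ Finset.univ.erase j, a k) := by rw [← Finset.sum_mul, hdA, mul_assoc]

/-- A nonempty set of indices that is closed under the tensor matrix contains all of them. -/
theorem eq_univ_of_closed (hχ : IsMcKayFamily φ χ) {A : Matrix (Fin (r + 1)) (Fin (r + 1)) ℕ}
    (hA : IsTensorMatrix φ χ A) (s : Finset (Fin (r + 1))) (hs : s.Nonempty)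
    (hcl : ∀ i j, A i j ≠ 0 → (i ∈ s ↔ j ∈ s)) : s = Finset.univ := by
  obtain ⟨δ, hδ, hnull⟩ := hχ.exists_null_vector hA
  -- No edge leaves `s`, so the null vector cut down to `s` still gives ρ f = 2f. For all indices
  -- together, `f` plays the role of the regular character.
  set f : Γ → ℂ := fun g => ∑ i ∈ s, (δ i : ℂ) * χ i g with hf
  have hsf : ∀ g, stdChar φ g * f g = 2 * f g := fun g => by
    calc stdChar φ g * f g = ∑ i ∈ s, ∑ j, ((A i j * δ i : ℕ) : ℂ) * χ j g := by
          rw [hf, Finset.mul_sum]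
          refine Finset.sum_congr rfl fun i _ => ?_
          rw [mul_left_comm, hA i g, Finset.mul_sum]
          exact Finset.sum_congr rfl fun j _ => by push_cast; ring
      _ = ∑ j, ((∑ i ∈ s, A i j * δ i : ℕ) : ℂ) * χ j g := by
          rw [Finset.sum_comm]
          exact Finset.sum_congr rfl fun j _ => by rw [Nat.cast_sum, Finset.sum_mul]
      _ = ∑ j ∈ s, ((2 * δ j : ℕ) : ℂ) * χ j g := by
          symm
          apply Finset.sum_subset_zero_on_sdiff (Finset.subset_univ s)
          · intro j hj
            rw [Finset.sum_eq_zero, Nat.cast_zero, zero_mul]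
            intro i hi
            by_contra h
            exact (Finset.mem_sdiff.1 hj).2 ((hcl i j (left_ne_zero_of_mul h)).1 hi)
          · intro j hj
            rw [← hnull j]
            congr 2
            symm
            apply Finset.sum_subset (Finset.subset_univ s)
            intro i _ hi
            by_contra h
            exact hi ((hcl i j (left_ne_zero_of_mul h)).2 hj)
      _ = 2 * f g := by
          rw [hf, Finset.mul_sum]
          exact Finset.sum_congr rfl fun j _ => by push_cast; ring
  have hf0 : ∀ g, g ≠ 1 → f g = 0 := fun g hg => by
    have h : (stdChar φ g - 2) * f g = 0 := by rw [sub_mul, hsf, sub_self]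
    refine (mul_eq_zero.1 h).resolve_left fun h2 => hg ?_
    exact eq_one_of_stdChar_eq_two φ hχ.injective g (sub_eq_zero.1 h2)
  choose d hd hχd using hχ.degree
  have hf1 : f 1 ≠ 0 := by
    have h1 : f 1 = ((∑ i ∈ s, δ i * d i : ℕ) : ℂ) := by
      simp [hf, hχd]
    rw [h1, Nat.cast_ne_zero]
    exact (Finset.sum_pos (fun i _ => Nat.mul_pos (hδ i) (hd i)) hs).ne'
  ext j
  simp only [Finset.mem_univ, iff_true]
  by_contra hj
  -- For `j` outside `s` orthogonality makes ⟨f, χ_j⟩ zero, but the only surviving term is f(1)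
  -- χ_j(1) / |Γ|, which is not.
  have h1 := hχ.pair_sum s (fun i => (δ i : ℂ)) j
  rw [if_neg hj, charPair, Finset.sum_eq_single 1, inv_one, hχd] at h1
  · refine mul_ne_zero (inv_ne_zero (Nat.cast_ne_zero.2 Fintype.card_ne_zero))
      (mul_ne_zero hf1 (Nat.cast_ne_zero.2 (hd j).ne')) h1
  · intro g _ hg
    exact mul_eq_zero_of_left (hf0 g hg) _
  · simp

/-! ### Affine Cartan matrices and Ebeling's formula for McKay families. -/

variable {B : Matrix (Fin (r + 1)) (Fin (r + 1)) ℕ}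

theorem cartanOf_of_ne (B : Matrix (Fin (r + 1)) (Fin (r + 1)) ℕ) {i j : Fin (r + 1)}
    (h : i ≠ j) : cartanOf B i j = -(B i j : ℤ) := by
  rw [cartanOf, Matrix.sub_apply, Matrix.smul_apply, Matrix.one_apply_ne h, smul_zero, zero_sub,
    Matrix.map_apply]

theorem cartanOf_diag (hχ : IsMcKayFamily φ χ) (hB : IsTensorMatrix φ χ B.transpose)
    (i : Fin (r + 1)) : cartanOf B i i = 2 := by
  obtain ⟨c, hc⟩ := hχ.exists_coloring hB
  have : B i i = 0 := hc i i rfl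
  rw [cartanOf, Matrix.sub_apply, Matrix.smul_apply, Matrix.one_apply_eq, Matrix.map_apply, this]
  rfl

theorem eq_zero_symm (hχ : IsMcKayFamily φ χ) {A : Matrix (Fin (r + 1)) (Fin (r + 1)) ℕ}
    (hA : IsTensorMatrix φ χ A) {i j : Fin (r + 1)} (h : A i j = 0) : A j i = 0 := by
  have := hχ.symmetrizable hA i j
  rw [h, Nat.cast_zero, zero_mul] at this
  exact_mod_cast (mul_eq_zero.1 this.symm).resolve_right (hχ.pair_self_ne_zero i)

theorem isAffineCartan (hχ : IsMcKayFamily φ χ) (hB : IsTensorMatrix φ χ B.transpose) :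
    IsAffineCartan (cartanOf B) where
  diag := hχ.cartanOf_diag hB
  off_diag i j hij := by rw [cartanOf_of_ne B hij]; simp
  zero_symm i j h := by
    have hij : i ≠ j := by rintro rfl; rw [hχ.cartanOf_diag hB] at h; norm_num at h
    rw [cartanOf_of_ne B hij] at h
    rw [cartanOf_of_ne B hij.symm]
    have h' : B.transpose j i = 0 := by simpa using h
    have := hχ.eq_zero_symm hB h'
    simpa using this
  connected := by
    classical
    rw [SimpleGraph.connected_iff_exists_forall_reachable]
    refine ⟨0, fun v => ?_⟩
    have := hχ.eq_univ_of_closed hB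
      (Finset.univ.filter fun v => (diagram (cartanOf B)).Reachable 0 v) ⟨0, by simp⟩ ?_
    · have hv := Finset.mem_univ v
      rw [← this] at hv
      simpa using hv
    · intro i j hij
      obtain ⟨c, hc⟩ := hχ.exists_coloring hB
      have hne : i ≠ j := by rintro rfl; exact hij (hc _ _ rfl)
      have hadj : (diagram (cartanOf B)).Adj i j := by
        refine ⟨hne, Or.inr ?_⟩
        change cartanOf B j i ≠ 0
        rw [cartanOf_of_ne B hne.symm, neg_ne_zero, Nat.cast_ne_zero]
        exact hij
      simp only [Finset.mem_filter, Finset.mem_univ, true_and]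
      exact ⟨fun h => h.trans hadj.reachable, fun h => h.trans hadj.symm.reachable⟩
  null_vector := by
    obtain ⟨δ, hδ, hnull⟩ := hχ.exists_null_vector hB
    refine ⟨fun i => δ i, fun i => Nat.cast_pos.2 (hδ i), ?_⟩
    ext j
    have h1 : ∑ i, (B j i : ℤ) * δ i = 2 * δ j := by exact_mod_cast hnull j
    rw [cartanOf, Matrix.sub_mulVec, Matrix.smul_mulVec, Matrix.one_mulVec]
    simp only [Pi.sub_apply, Pi.smul_apply, Matrix.mulVec, dotProduct, Matrix.map_apply, h1]
    simp

theorem exists_isBicoloredOrder (hχ : IsMcKayFamily φ χ)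
    (hB : IsTensorMatrix φ χ B.transpose) : ∃ l, IsBicoloredOrder (cartanOf B) l := by
  obtain ⟨c, hc⟩ := hχ.exists_coloring hB
  have hadj : ∀ i j, c i = c j → ¬ (diagram (cartanOf B)).Adj i j := by
    rintro i j hij ⟨hne, h⟩
    change cartanOf B i j ≠ 0 ∨ cartanOf B j i ≠ 0 at h
    rw [cartanOf_of_ne B hne, cartanOf_of_ne B hne.symm] at h
    have h1 : B i j = 0 := hc j i hij.symm
    have h2 : B j i = 0 := hc i j hij
    simp [h1, h2] at h
  let u := (Finset.univ.filter fun i => c i = true).toList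
  let v := (Finset.univ.filter fun i => c i = false).toList
  refine ⟨u ++ v, ⟨?_, fun i => ?_⟩, u, v, rfl, ?_, ?_⟩
  · refine List.Nodup.append (Finset.nodup_toList _) (Finset.nodup_toList _) ?_
    intro i hi hi'
    simp only [u, v, Finset.mem_toList, Finset.mem_filter] at hi hi'
    rw [hi.2] at hi'
    exact Bool.noConfusion hi'.2
  · cases h : c i <;> simp [u, v, h]
  · intro i hi j hj
    simp only [u, Finset.mem_toList, Finset.mem_filter] at hi hj
    exact hadj i j (hi.2.trans hj.2.symm)
  · intro i hi j hj
    simp only [v, Finset.mem_toList, Finset.mem_filter] at hi hj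
    exact hadj i j (hi.2.trans hj.2.symm)

/-- The multiplicity series satisfy `((1 + t ^ 2) I - t Bᵀ) P = e₀`. -/
theorem transpose_coxeterPencil_mulVec (hχ : IsMcKayFamily φ χ)
    (hB : IsTensorMatrix φ χ B.transpose) :
    (coxeterPencil (cartanOf B)).transpose.mulVec (fun i => PowerSeries.mk fun n =>
      charPair (Representation.character ((symPow n).comp φ)) (χ i)) = Pi.single 0 1 := by
  set P : Fin (r + 1) → PowerSeries ℂ := fun i => PowerSeries.mk fun n =>
      charPair (Representation.character ((symPow n).comp φ)) (χ i) with hP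
  obtain ⟨c, hc⟩ := hχ.exists_coloring hB
  -- The diagonal of the pencil omits the entries `B i i`, which vanish by the coloring.
  have hpencil : ∀ i j, (coxeterPencil (cartanOf B)).transpose i j =
      (1 + PowerSeries.X ^ 2) * (1 : Matrix _ _ (PowerSeries ℂ)) i j -
        PowerSeries.X * (B j i : PowerSeries ℂ) := fun i j => by
    by_cases hij : i = j
    · subst hij
      have : B i i = 0 := hc i i rfl
      simp [coxeterPencil, this]
    · simp [coxeterPencil, hij, Ne.symm hij, cartanOf_of_ne B (Ne.symm hij)]
  -- Self-adjointness moves ρ from χ_i to π_n, where Clebsch–Gordan applies.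
  have hrec : ∀ i n, ∑ j, (B j i : ℂ) *
      charPair (Representation.character ((symPow n).comp φ)) (χ j) =
      charPair (fun g => stdChar φ g * Representation.character ((symPow n).comp φ) g) (χ i) := by
    intro i n
    have h1 : (fun g => stdChar φ g * χ i g) = fun g => ∑ j, (B j i : ℂ) * χ j g :=
      funext (hB i)
    rw [charPair_stdChar, charPair_comm, h1, charPair_sum_left]
    exact Finset.sum_congr rfl fun j _ => by rw [charPair_comm]
  ext1 i
  have h1 : (coxeterPencil (cartanOf B)).transpose.mulVec P i =
      (1 + PowerSeries.X ^ 2) * P i - PowerSeries.X * ∑ j, (B j i : PowerSeries ℂ) * P j := by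
    simp only [Matrix.mulVec, dotProduct, hpencil, sub_mul, Finset.sum_sub_distrib]
    congr 1
    · rw [Finset.sum_eq_single i]
      · simp
      · intro j _ hj
        simp [Matrix.one_apply_ne hj.symm]
      · simp
    · rw [Finset.mul_sum]
      exact Finset.sum_congr rfl fun j _ => by ring
  have hcoeff : ∀ n, PowerSeries.coeff n (∑ j, (B j i : PowerSeries ℂ) * P j) =
      charPair (fun g => stdChar φ g * Representation.character ((symPow n).comp φ) g)
        (χ i) := fun n => by
    rw [map_sum, ← hrec]
    refine Finset.sum_congr rfl fun j _ => ?_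
    rw [← nsmul_eq_mul, map_nsmul, nsmul_eq_mul, hP, PowerSeries.coeff_mk]
  have hchar0 : Representation.character ((symPow 0).comp φ) = 1 :=
    funext fun g => character_symPow_zero φ g
  rw [h1]
  ext n
  have hPn : ∀ m, PowerSeries.coeff m (P i) =
      charPair (Representation.character ((symPow m).comp φ)) (χ i) := fun m => by
    rw [hP, PowerSeries.coeff_mk]
  have hrhs : PowerSeries.coeff n ((Pi.single 0 1 : Fin (r + 1) → PowerSeries ℂ) i) =
      if n = 0 then (if i = 0 then 1 else 0) else 0 := by
    by_cases hi : i = 0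
    · subst hi
      simp [PowerSeries.coeff_one]
    · simp [hi]
  rw [hrhs, add_mul, one_mul, map_sub, map_add]
  -- Degree 0 is the pairing of the trivial character with χ_i. Degree 1 says that π_1 is ρ, and the
  -- higher degrees are the Clebsch–Gordan recursion.
  match n with
  | 0 =>
    rw [hPn, hchar0, hχ.pair_one]
    simp
  | 1 =>
    rw [PowerSeries.coeff_succ_X_mul, hcoeff, hPn, PowerSeries.coeff_X_pow_mul', hchar0]
    simp [← character_symPow_one]
  | n + 2 =>
    rw [PowerSeries.coeff_succ_X_mul, hcoeff, hPn, PowerSeries.coeff_X_pow_mul, hPn]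
    simp only [stdChar_mul_character_symPow, charPair_add_left]
    simp

theorem ebelingFormula (hχ : IsMcKayFamily φ χ) (hB : IsTensorMatrix φ χ B.transpose) :
    EbelingFormula B (kostantSeries φ (χ 0)) := by
  refine ⟨hχ.isAffineCartan hB, hχ.exists_isBicoloredOrder hB, fun l l₀ hl hl₀ => ?_⟩
  have hdiag := hχ.cartanOf_diag hB
  rw [hl.detSq_eq hdiag, hl₀.detSq_eq fun i => hdiag i.succ]
  have hcc := constantCoeff_det_coxeterPencil (cartanOf B)
  refine ⟨by rw [hcc]; exact one_ne_zero, ?_⟩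
  have h := det_mul_eq_det_submatrix_of_transpose_mulVec _ _
    (hχ.transpose_coxeterPencil_mulVec hB)
  have hsub : (coxeterPencil (cartanOf B)).submatrix Fin.succ Fin.succ =
      coxeterPencil (deleteZero (cartanOf B)) := by
    ext1 i j
    simp [coxeterPencil, deleteZero]
  rw [hsub] at h
  rw [PowerSeries.eq_mul_inv_iff_mul_eq (by rw [hcc]; exact one_ne_zero), ← h, mul_comm]
  congr 1
  ext n
  rw [kostantSeries, PowerSeries.coeff_mk, PowerSeries.coeff_mk,
    charInner_eq_charPair _ _ hχ.conj_zero]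

end IsMcKayFamily

/-! ### Irreducible characters -/

section Irreducible

open Representation

variable {Γ : Type} [Group Γ]

theorem character_eq_add_of_isCompl {V : Type*} [AddCommGroup V] [Module ℂ V]
    [FiniteDimensional ℂ V] (ρ : Representation ℂ Γ V) (W W' : Subrepresentation ρ)
    (h : IsCompl W.toSubmodule W'.toSubmodule) :
    ρ.character = W.toRepresentation.character + W'.toRepresentation.character := by
  ext g
  rw [Pi.add_apply, character, character, character, ← LinearMap.trace_prodMap',
    ← LinearMap.trace_conj' _ (Submodule.prodEquivOfIsCompl _ _ h)]
  congr 1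
  apply LinearMap.ext
  intro v
  obtain ⟨⟨w, w'⟩, rfl⟩ := (Submodule.prodEquivOfIsCompl _ _ h).surjective v
  simp [LinearEquiv.conj_apply_apply, Subrepresentation.toRepresentation]

/-- Every character of a finite group is a sum of irreducible characters. -/
theorem character_mem_closure_irrChars [Finite Γ] (V : Type) [AddCommGroup V] [Module ℂ V]
    [FiniteDimensional ℂ V] (ρ : Representation ℂ Γ V) :
    ρ.character ∈ AddSubmonoid.closure (irrChars Γ) := by
  induction hn : Module.finrank ℂ V using Nat.strong_induction_on generalizing V with
  | _ n ih =>
    by_cases hirr : ρ.IsIrreducible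
    · exact AddSubmonoid.subset_closure ⟨V, _, _, inferInstance, ρ, hirr, rfl⟩
    by_cases hV : Subsingleton V
    · have : ρ.character = 0 := by
        ext g
        rw [character, Subsingleton.elim (ρ g) 0, map_zero, Pi.zero_apply]
      rw [this]
      exact zero_mem _
    · rw [not_subsingleton_iff_nontrivial] at hV
      have hW : ∃ W : Subrepresentation ρ, W.toSubmodule ≠ ⊥ ∧ W.toSubmodule ≠ ⊤ := by
        by_contra hcon
        push Not at hcon
        have : Nontrivial (Subrepresentation ρ) :=
          ⟨⊥, ⊤, fun h => bot_ne_top (α := Submodule ℂ V)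
            (congrArg Subrepresentation.toSubmodule h)⟩
        refine hirr ⟨fun W => ?_⟩
        by_cases h : W.toSubmodule = ⊥
        · exact Or.inl (Subrepresentation.toSubmodule_injective h)
        · exact Or.inr (Subrepresentation.toSubmodule_injective (hcon W h))
      obtain ⟨W, hbot, htop⟩ := hW
      have : NeZero (Nat.card Γ : ℂ) := ⟨Nat.cast_ne_zero.2 Nat.card_pos.ne'⟩
      obtain ⟨W', hWW'⟩ := exists_isCompl W
      have hc : IsCompl W.toSubmodule W'.toSubmodule := by
        rw [isCompl_iff, disjoint_iff, codisjoint_iff] at hWW' ⊢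
        exact ⟨congrArg Subrepresentation.toSubmodule hWW'.1,
          congrArg Subrepresentation.toSubmodule hWW'.2⟩
      have hW' : W'.toSubmodule ≠ ⊤ := fun h => by
        rw [h] at hc
        exact hbot (disjoint_top.1 hc.disjoint)
      rw [character_eq_add_of_isCompl ρ W W' hc]
      exact add_mem
        (ih _ (hn ▸ Submodule.finrank_lt htop) _ W.toRepresentation rfl)
        (ih _ (hn ▸ Submodule.finrank_lt hW') _ W'.toRepresentation rfl)

theorem charPair_character [Fintype Γ] {V W : Type*} [AddCommGroup V] [Module ℂ V]
    [FiniteDimensional ℂ V] [AddCommGroup W] [Module ℂ W] [FiniteDimensional ℂ W]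
    (ρ : Representation ℂ Γ V) (σ : Representation ℂ Γ W) :
    charPair σ.character ρ.character = Module.finrank ℂ (IntertwiningMap ρ σ) := by
  let _ : Invertible (Nat.card Γ : ℂ) := invertibleOfNonzero (Nat.cast_ne_zero.2 Nat.card_pos.ne')
  rw [← card_inv_mul_sum_char_mul_char_eq_finrank, charPair, Fintype.card_eq_nat_card]

theorem charPair_character_one [Fintype Γ] {V : Type*} [AddCommGroup V] [Module ℂ V]
    [FiniteDimensional ℂ V] (ρ : Representation ℂ Γ V) :
    charPair ρ.character 1 = Module.finrank ℂ ρ.invariants := by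
  let _ : Invertible (Nat.card Γ : ℂ) := invertibleOfNonzero (Nat.cast_ne_zero.2 Nat.card_pos.ne')
  rw [← card_inv_mul_sum_char_eq_finrank, charPair, Fintype.card_eq_nat_card]
  simp

open scoped Classical in
theorem charPair_irrChars [Fintype Γ] {χ ψ : Γ → ℂ} (hχ : χ ∈ irrChars Γ) (hψ : ψ ∈ irrChars Γ) :
    charPair χ ψ = if χ = ψ then 1 else 0 := by
  obtain ⟨V, _, _, _, ρ, hρ, rfl⟩ := hχ
  obtain ⟨W, _, _, _, σ, hσ, rfl⟩ := hψ
  let _ : Invertible (Nat.card Γ : ℂ) := invertibleOfNonzero (Nat.cast_ne_zero.2 Nat.card_pos.ne')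
  have h1 : charPair ρ.character σ.character = if Nonempty (σ.Equiv ρ) then 1 else 0 := by
    rw [charPair, Fintype.card_eq_nat_card, char_orthonormal]
  have h2 : charPair ρ.character ρ.character = if Nonempty (ρ.Equiv ρ) then 1 else 0 := by
    rw [charPair, Fintype.card_eq_nat_card, char_orthonormal]
  by_cases h : Nonempty (σ.Equiv ρ)
  · rw [h1, if_pos h, if_pos (char_iso h.some).symm]
  · rw [h1, if_neg h, if_neg]
    -- If non-isomorphic irreducibles had equal characters, the norm of the character would be both
    -- 0 and 1.
    intro heq
    rw [← heq, h2, if_pos ⟨Representation.Equiv.refl ρ⟩, if_neg h] at h1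
    exact one_ne_zero h1

theorem irrChars.exists_degree {χ : Γ → ℂ} (hχ : χ ∈ irrChars Γ) :
    ∃ d : ℕ, 0 < d ∧ χ 1 = d := by
  obtain ⟨V, _, _, _, ρ, hρ, rfl⟩ := hχ
  refine ⟨_, ?_, char_one ρ⟩
  have : Nontrivial V := by
    by_contra h
    rw [not_nontrivial_iff_subsingleton] at h
    exact bot_ne_top (α := Subrepresentation ρ)
      (Subrepresentation.toSubmodule_injective (Subsingleton.elim _ _))
  exact Module.finrank_pos

/-- A central involution acts in an irreducible representation by `1` or `-1`. -/
theorem irrChars.parity {χ : Γ → ℂ} (hχ : χ ∈ irrChars Γ) {z : Γ} (hz : z * z = 1)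
    (hc : ∀ g, z * g = g * z) : (∀ g, χ (z * g) = χ g) ∨ (∀ g, χ (z * g) = -χ g) := by
  obtain ⟨V, _, _, _, ρ, hρ, rfl⟩ := hχ
  let W : Subrepresentation ρ := ⟨LinearMap.eqLocus (ρ z) LinearMap.id, fun g v hv => by
    rw [LinearMap.mem_eqLocus, LinearMap.id_apply] at hv ⊢
    rw [← Module.End.mul_apply, ← map_mul, hc, map_mul, Module.End.mul_apply, hv]⟩
  have hzz : ∀ v, ρ z (ρ z v) = v := fun v => by
    rw [← Module.End.mul_apply, ← map_mul, hz, map_one, Module.End.one_apply]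
  rcases eq_bot_or_eq_top W with h | h
  · right
    have h1 : ρ z = -1 := by
      ext v
      -- The vector v + zv is fixed by the involution z, so it vanishes when z has no nonzero fixed
      -- vector.
      have hm : v + ρ z v ∈ W.toSubmodule := by
        rw [LinearMap.mem_eqLocus, map_add, hzz, LinearMap.id_apply, add_comm]
      rw [congrArg Subrepresentation.toSubmodule h] at hm
      exact eq_neg_of_add_eq_zero_right ((Submodule.mem_bot ℂ).1 hm)
    intro g
    rw [character, map_mul, h1, neg_one_mul, map_neg]
    rfl
  · left
    have h1 : ρ z = 1 := by
      ext v
      have hm : v ∈ W.toSubmodule := by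
        rw [congrArg Subrepresentation.toSubmodule h]
        exact Submodule.mem_top
      exact hm
    intro g
    rw [character, map_mul, h1, one_mul]
    rfl

/-- Irreducibility depends only on the lattice of stable subspaces. This covers both conjugation by
an automorphism and twisting by a linear character. -/
theorem isIrreducible_of_stable_iff {Γ' V : Type*} [Group Γ'] [AddCommGroup V] [Module ℂ V]
    {ρ : Representation ℂ Γ V} {σ : Representation ℂ Γ' V}
    (h : ∀ W : Submodule ℂ V, (∀ g, ∀ v ∈ W, ρ g v ∈ W) ↔ ∀ g, ∀ v ∈ W, σ g v ∈ W)
    (hρ : ρ.IsIrreducible) : σ.IsIrreducible := by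
  let e : Subrepresentation ρ ≃o Subrepresentation σ :=
    { toFun := fun W => ⟨W.toSubmodule, (h _).1 W.apply_mem_toSubmodule⟩
      invFun := fun W => ⟨W.toSubmodule, (h _).2 W.apply_mem_toSubmodule⟩
      left_inv := fun _ => rfl
      right_inv := fun _ => rfl
      map_rel_iff' := Iff.rfl }
  exact e.isSimpleOrder_iff.1 hρ

theorem irrChars.comp_mulEquiv {Γ' : Type} [Group Γ'] {χ : Γ → ℂ} (hχ : χ ∈ irrChars Γ)
    (e : Γ' ≃* Γ) : (fun g => χ (e g)) ∈ irrChars Γ' := by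
  obtain ⟨V, _, _, _, ρ, hρ, rfl⟩ := hχ
  refine ⟨V, _, _, inferInstance, ρ.comp e.toMonoidHom, isIrreducible_of_stable_iff (fun W => ?_)
    hρ, rfl⟩
  exact e.surjective.forall

theorem irrChars.twist {χ : Γ → ℂ} (hχ : χ ∈ irrChars Γ) (l : Γ →* ℂˣ) :
    (fun g => (l g : ℂ) * χ g) ∈ irrChars Γ := by
  obtain ⟨V, _, _, _, ρ, hρ, rfl⟩ := hχ
  let σ : Representation ℂ Γ V :=
    { toFun := fun g => (l g : ℂ) • ρ g
      map_one' := by simp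
      map_mul' := fun g h => by
        rw [map_mul, map_mul, Units.val_mul, smul_mul_smul_comm] }
  refine ⟨V, _, _, inferInstance, σ, isIrreducible_of_stable_iff (fun W => ?_) hρ, ?_⟩
  · refine forall_congr' fun g => forall₂_congr fun v _ => ?_
    exact (W.smul_mem_iff (Units.ne_zero (l g))).symm
  · ext g
    change _ = LinearMap.trace ℂ V ((l g : ℂ) • ρ g)
    rw [map_smul]
    rfl

theorem trivialChar_eq_one : trivialChar Γ = 1 := by
  ext g
  simp [trivialChar, character]

theorem one_mem_irrChars : (1 : Γ → ℂ) ∈ irrChars Γ := by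
  refine ⟨ℂ, _, _, inferInstance, Representation.trivial ℂ Γ ℂ, ?_, trivialChar_eq_one.symm⟩
  have : Nontrivial (Subrepresentation (Representation.trivial ℂ Γ ℂ)) :=
    ⟨⊥, ⊤, fun h => bot_ne_top (α := Submodule ℂ ℂ)
      (congrArg Subrepresentation.toSubmodule h)⟩
  refine ⟨fun W => ?_⟩
  rcases eq_bot_or_eq_top W.toSubmodule with h | h
  · exact Or.inl (Subrepresentation.toSubmodule_injective h)
  · exact Or.inr (Subrepresentation.toSubmodule_injective h)

theorem stdChar_mul_mem_closure_irrChars [Finite Γ] (φ : Γ →* SU2) {χ : Γ → ℂ}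
    (hχ : χ ∈ irrChars Γ) :
    (fun g => stdChar φ g * χ g) ∈ AddSubmonoid.closure (irrChars Γ) := by
  obtain ⟨V, _, _, _, ρ, hρ, rfl⟩ := hχ
  have := character_mem_closure_irrChars
    (TensorProduct ℂ (MvPolynomial.homogeneousSubmodule (Fin 2) ℂ 1) V)
    (Representation.tprod ((symPow 1).comp φ) ρ)
  rw [char_tensor] at this
  convert this using 1
  ext g
  rw [Pi.mul_apply, character_symPow_one]

end Irreducible

/-! ### Induced characters -/

section Induced

open Representation

theorem trace_of_basis_map {ι M : Type*} [Fintype ι] [DecidableEq ι] [AddCommGroup M]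
    [Module ℂ M] (b : Module.Basis ι ℂ M) (f : ι → ι) (T : Module.End ℂ M)
    (hT : ∀ i, T (b i) = b (f i)) :
    LinearMap.trace ℂ M T = ∑ i, if f i = i then 1 else 0 := by
  rw [LinearMap.trace_eq_matrix_trace ℂ b, Matrix.trace]
  refine Finset.sum_congr rfl fun i _ => ?_
  rw [Matrix.diag_apply, LinearMap.toMatrix_apply, hT, Module.Basis.repr_self,
    Finsupp.single_apply]

/-- The trace on the coinvariants of a finite group. -/
theorem trace_coinvariants_map {Δ V : Type*} [Group Δ] [Fintype Δ] [AddCommGroup V]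
    [Module ℂ V] [FiniteDimensional ℂ V] (σ : Representation ℂ Δ V) (T : IntertwiningMap σ σ) :
    LinearMap.trace ℂ _ (Coinvariants.map σ σ T) =
      (Fintype.card Δ : ℂ)⁻¹ * ∑ h, LinearMap.trace ℂ V (T.toLinearMap ∘ₗ σ h) := by
  -- The averaging operator factors through the coinvariants as a section of the quotient map, and
  -- cyclicity of the trace moves the computation back to V.
  let p : V →ₗ[ℂ] V := (Fintype.card Δ : ℂ)⁻¹ • ∑ h, σ h
  have hp : ∀ x, p ∘ₗ σ x = p := fun x => by
    rw [← Module.End.mul_eq_comp, smul_mul_assoc, Finset.sum_mul]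
    congr 1
    rw [← Equiv.sum_comp (Equiv.mulRight x) fun h => σ h]
    exact Finset.sum_congr rfl fun h _ => (map_mul σ h x).symm
  let s := Coinvariants.lift σ p hp
  have hs : Coinvariants.mk σ ∘ₗ s = LinearMap.id := by
    apply Coinvariants.hom_ext
    ext v
    simp only [LinearMap.comp_apply, s, Coinvariants.lift_mk, p, LinearMap.smul_apply,
      LinearMap.sum_apply, map_smul, map_sum, Coinvariants.mk_self_apply, LinearMap.id_apply,
      Finset.sum_const, Finset.card_univ]
    rw [← Nat.cast_smul_eq_nsmul ℂ, smul_smul,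
      inv_mul_cancel₀ (Nat.cast_ne_zero.2 Fintype.card_ne_zero), one_smul]
  calc LinearMap.trace ℂ _ (Coinvariants.map σ σ T)
      = LinearMap.trace ℂ _ (Coinvariants.mk σ ∘ₗ (T.toLinearMap ∘ₗ s)) := by
        conv_lhs => rw [← LinearMap.comp_id (Coinvariants.map σ σ T), ← hs, ← LinearMap.comp_assoc]
        rfl
    _ = LinearMap.trace ℂ _ ((T.toLinearMap ∘ₗ s) ∘ₗ Coinvariants.mk σ) :=
        LinearMap.trace_comp_comm' _ _
    _ = LinearMap.trace ℂ _ (T.toLinearMap ∘ₗ p) := by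
        rw [LinearMap.comp_assoc, Coinvariants.lift_comp_mk]
    _ = _ := by
        rw [← Module.End.mul_eq_comp, mul_smul_comm, Finset.mul_sum, map_smul, map_sum,
          smul_eq_mul]
        rfl

variable {Γ : Type*} [Group Γ] {H : Subgroup Γ}

open scoped Classical in
/-- The extension by zero of a function on a subgroup. -/
noncomputable def extendByZero (f : H → ℂ) (y : Γ) : ℂ := if hy : y ∈ H then f ⟨y, hy⟩ else 0

theorem extendByZero_coe (f : H → ℂ) (h : H) : extendByZero f (h : Γ) = f h := by
  simp [extendByZero]

theorem extendByZero_of_notMem (f : H → ℂ) {y : Γ} (hy : y ∉ H) : extendByZero f y = 0 := by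
  simp [extendByZero, hy]

theorem sum_mul_extendByZero [Fintype Γ] [Fintype H] (F : Γ → ℂ) (f : H → ℂ) :
    ∑ y, F y * extendByZero f y = ∑ h : H, F h * f h := by
  classical
  rw [← Finset.sum_subset (Finset.subset_univ (Finset.univ.filter (· ∈ H)))]
  · rw [Finset.sum_subtype (p := (· ∈ H)) _ (by simp)]
    exact Finset.sum_congr rfl fun h _ => by rw [extendByZero_coe]
  · intro y _ hy
    rw [extendByZero_of_notMem f (by simpa using hy), mul_zero]

/-- Induction of class functions. -/
noncomputable def indFun [Fintype Γ] [Fintype H] : (H → ℂ) →+ (Γ → ℂ) where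
  toFun f g := (Fintype.card H : ℂ)⁻¹ * ∑ x, extendByZero f (x * g * x⁻¹)
  map_zero' := by
    ext g
    have : ∀ y, extendByZero (0 : H → ℂ) y = 0 := fun y => by simp [extendByZero]
    simp [this]
  map_add' f f' := by
    ext g
    have : ∀ y, extendByZero (f + f') y = extendByZero f y + extendByZero f' y := fun y => by
      by_cases hy : y ∈ H <;> simp [extendByZero, hy]
    simp only [this, Finset.sum_add_distrib, mul_add, Pi.add_apply]

theorem indFun_apply [Fintype Γ] [Fintype H] (f : H → ℂ) (g : Γ) :
    indFun f g = (Fintype.card H : ℂ)⁻¹ * ∑ x, extendByZero f (x * g * x⁻¹) := rfl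

/-- The induced representation is the space of H-coinvariants of ℂ[Γ] ⊗ V, on which g acts by right
translation by g⁻¹. Its trace is an average over h ∈ H, and the basis element x contributes when h x
g⁻¹ = x, that is, when h = x g x⁻¹. -/
theorem character_ind [Fintype Γ] [Fintype H] {V : Type*} [AddCommGroup V] [Module ℂ V]
    [FiniteDimensional ℂ V] (τ : Representation ℂ H V) :
    (ind H.subtype τ).character = indFun τ.character := by
  classical
  ext g
  have : Module.Finite ℂ (MonoidAlgebra ℂ Γ) :=
    Module.Finite.of_basis (MonoidAlgebra.basis Γ ℂ)
  rw [character, ind_apply, trace_coinvariants_map, indFun_apply]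
  congr 1
  have h1 : ∀ h : H, LinearMap.trace ℂ _ (((MonoidAlgebra.mapDomainLinearMap ℂ ℂ
      fun x : Γ => x * g⁻¹).rTensor V) ∘ₗ
        (Representation.tprod ((leftRegular ℂ Γ).comp H.subtype) τ) h) =
      ∑ x : Γ, (if (h : Γ) = x * g * x⁻¹ then 1 else 0) * τ.character h := fun h => by
    rw [Representation.tprod_apply, LinearMap.rTensor_comp_map, LinearMap.trace_tensorProduct',
      trace_of_basis_map (MonoidAlgebra.basis Γ ℂ) (fun x => h * x * g⁻¹), Finset.sum_mul]
    · refine Finset.sum_congr rfl fun x _ => ?_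
      have : (h : Γ) * x * g⁻¹ = x ↔ (h : Γ) = x * g * x⁻¹ := by
        rw [mul_inv_eq_iff_eq_mul, eq_mul_inv_iff_mul_eq]
      simp only [this]
      rfl
    · intro x
      simp
  refine (Finset.sum_congr rfl fun h _ => h1 h).trans ?_
  rw [Finset.sum_comm]
  refine Finset.sum_congr rfl fun x _ => ?_
  rw [← sum_mul_extendByZero (fun y => if y = x * g * x⁻¹ then 1 else 0)]
  simp

end Induced

/-! ### The McKay operator -/

section Families

variable {Γ : Type} [Group Γ]

theorem poincareSeries_eq [Fintype Γ] (φ : Γ →* SU2) : poincareSeries φ = PowerSeries.mk fun n =>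
    charPair (Representation.character ((symPow n).comp φ)) 1 := by
  ext n
  rw [poincareSeries, PowerSeries.coeff_mk, PowerSeries.coeff_mk, charPair_character_one,
    finrank_invariants_symPow]

theorem kostantSeries_one [Fintype Γ] (φ : Γ →* SU2) : kostantSeries φ 1 = poincareSeries φ := by
  rw [poincareSeries_eq]
  ext n
  rw [kostantSeries, PowerSeries.coeff_mk, PowerSeries.coeff_mk,
    charInner_eq_charPair _ _ (by simp)]

theorem existsUnique_isTensorMatrix [Fintype Γ] {φ : Γ →* SU2} {r : ℕ} {χ : Fin (r + 1) → Γ → ℂ}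
    (hχ : IsMcKayFamily φ χ)
    (h : ∀ i, (fun g => stdChar φ g * χ i g) ∈ AddSubmonoid.closure (Set.range χ)) :
    ∃! A, IsTensorMatrix φ χ A := by
  obtain ⟨A, hA⟩ := exists_isTensorMatrix_of_mem_closure φ χ h
  exact ⟨A, hA, fun A' hA' => hχ.tensorMatrix_unique hA' hA⟩

/-- The Slodowy operators carry the summation index first, so they are transposes of tensor
matrices. -/
theorem existsUnique_isTensorMatrix_transpose [Fintype Γ] {φ : Γ →* SU2} {r : ℕ}
    {χ : Fin (r + 1) → Γ → ℂ} (hχ : IsMcKayFamily φ χ)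
    (h : ∀ i, (fun g => stdChar φ g * χ i g) ∈ AddSubmonoid.closure (Set.range χ)) :
    ∃! B : Matrix (Fin (r + 1)) (Fin (r + 1)) ℕ, IsTensorMatrix φ χ B.transpose := by
  obtain ⟨A, hA, hu⟩ := existsUnique_isTensorMatrix hχ h
  refine ⟨A.transpose, hA, fun B hB => ?_⟩
  rw [← hu _ hB, Matrix.transpose_transpose]

theorem isMcKayFamily_irrChars [Fintype Γ] {φ : Γ →* SU2} (hφ : Function.Injective φ)
    (heven : Even (Nat.card Γ)) {r : ℕ} {χ : Fin (r + 1) → Γ → ℂ}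
    (hχ : Enumerates χ (irrChars Γ)) (h0 : χ 0 = 1) : IsMcKayFamily φ χ := by
  classical
  have hmem : ∀ i, χ i ∈ irrChars Γ := fun i => hχ.2 ▸ Set.mem_range_self i
  have hpair : ∀ i j, charPair (χ i) (χ j) = if i = j then 1 else 0 := fun i j => by
    rw [charPair_irrChars (hmem i) (hmem j)]
    simp only [hχ.1.eq_iff]
  obtain ⟨z, hz⟩ := exists_coe_eq_neg_one φ hφ heven
  exact
  { injective := hφ
    orthogonal := fun i j hij => by rw [hpair, if_neg hij]
    norm := ⟨1, one_ne_zero, fun i => ⟨1, one_pos, by rw [hpair, if_pos rfl]; simp⟩⟩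
    degree := fun i => irrChars.exists_degree (hmem i)
    parity := ⟨z, hz, fun i => irrChars.parity (hmem i) (sq_eq_one_of_coe_eq_neg_one φ hφ hz)
      (commute_of_coe_eq_neg_one φ hφ hz)⟩
    pair_one := fun i => by
      rw [← h0, hpair]
      simp only [eq_comm]
    conj_zero := by simp [h0] }

/-- The McKay matrix is symmetric. -/
theorem tensorMatrix_irrChars_transpose [Fintype Γ] {φ : Γ →* SU2} {r : ℕ}
    {χ : Fin (r + 1) → Γ → ℂ} (hχ : Enumerates χ (irrChars Γ)) (hm : IsMcKayFamily φ χ)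
    {A : Matrix (Fin (r + 1)) (Fin (r + 1)) ℕ} (hA : IsTensorMatrix φ χ A) :
    A.transpose = A := by
  classical
  have hnorm : ∀ i, charPair (χ i) (χ i) = 1 := fun i => by
    have : χ i ∈ irrChars Γ := hχ.2 ▸ Set.mem_range_self i
    rw [charPair_irrChars this this, if_pos rfl]
  ext i j
  have := hm.symmetrizable hA i j
  rw [hnorm, hnorm, mul_one, mul_one] at this
  exact_mod_cast this.symm

/-! ### The Slodowy operator of restricted representations -/

theorem mem_restrictedChars_iff (H : Subgroup Γ) (χ : H → ℂ) :
    χ ∈ restrictedChars H ↔ ∃ ψ ∈ irrChars Γ, χ = fun h : H => ψ h := by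
  constructor
  · rintro ⟨V, _, _, _, ρ, hρ, rfl⟩
    exact ⟨ρ.character, ⟨V, _, _, inferInstance, ρ, hρ, rfl⟩, rfl⟩
  · rintro ⟨_, ⟨V, _, _, _, ρ, hρ, rfl⟩, rfl⟩
    exact ⟨V, _, _, inferInstance, ρ, hρ, rfl⟩

/-- Translation by a character l₀ with l₀(g) ≠ 1 permutes the summands and multiplies the sum by
l₀(g). -/
theorem sum_characters_quotient [Fintype Γ] (H : Subgroup Γ) [H.Normal] [IsCyclic (Γ ⧸ H)]
    [Fintype (Γ ⧸ H →* ℂˣ)] (g : Γ) (hg : g ∉ H) :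
    ∑ l : Γ ⧸ H →* ℂˣ, (l (g : Γ ⧸ H) : ℂ) = 0 := by
  let _ : CommGroup (Γ ⧸ H) := IsCyclic.commGroup
  have hg' : (g : Γ ⧸ H) ≠ 1 := fun h => hg ((QuotientGroup.eq_one_iff g).1 h)
  obtain ⟨l₀, hl₀⟩ := CommGroup.exists_apply_ne_one_of_hasEnoughRootsOfUnity (Γ ⧸ H) ℂ hg'
  have h : (l₀ (g : Γ ⧸ H) : ℂ) * ∑ l : Γ ⧸ H →* ℂˣ, (l (g : Γ ⧸ H) : ℂ) =
      ∑ l : Γ ⧸ H →* ℂˣ, (l (g : Γ ⧸ H) : ℂ) := by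
    rw [Finset.mul_sum, ← Equiv.sum_comp (Equiv.mulLeft l₀) fun l => (l (g : Γ ⧸ H) : ℂ)]
    exact Finset.sum_congr rfl fun l _ => by simp
  have h2 : ((l₀ (g : Γ ⧸ H) : ℂ) - 1) * ∑ l : Γ ⧸ H →* ℂˣ, (l (g : Γ ⧸ H) : ℂ) = 0 := by
    rw [sub_mul, h, one_mul, sub_self]
  refine (mul_eq_zero.1 h2).resolve_left fun h3 => hl₀ ?_
  exact Units.ext (sub_eq_zero.1 h3)

/-- Irreducible characters with restrictions to `H` that are not orthogonal have the same
restriction, if the quotient by `H` is cyclic. -/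
theorem restriction_eq_of_charPair_ne_zero [Fintype Γ] (H : Subgroup Γ) [H.Normal]
    [IsCyclic (Γ ⧸ H)] [Fintype H] {χ ψ : Γ → ℂ} (hχ : χ ∈ irrChars Γ) (hψ : ψ ∈ irrChars Γ)
    (h : charPair (fun h : H => χ h) (fun h : H => ψ h) ≠ 0) (x : H) : χ x = ψ x := by
  classical
  have : Finite (Γ ⧸ H →* ℂˣ) := by
    let _ : CommGroup (Γ ⧸ H) := IsCyclic.commGroup
    infer_instance
  let _ : Fintype (Γ ⧸ H →* ℂˣ) := Fintype.ofFinite _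
  by_contra hx
  apply h
  -- Every twist l χ restricts to χ on H. If the restrictions of χ and ψ differ, no twist equals ψ,
  -- and all twists are orthogonal to it.
  have htw : ∀ l : Γ ⧸ H →* ℂˣ, charPair (fun g : Γ => (l (g : Γ ⧸ H) : ℂ) * χ g) ψ = 0 := by
    intro l
    refine (charPair_irrChars (irrChars.twist hχ (l.comp (QuotientGroup.mk' H))) hψ).trans
      (if_neg fun heq => ?_)
    apply hx
    rw [← heq]
    have : ((x : Γ) : Γ ⧸ H) = 1 := (QuotientGroup.eq_one_iff _).2 x.2
    simp [this]
  have hsum : ∑ l : Γ ⧸ H →* ℂˣ, ∑ g : Γ, (l (g : Γ ⧸ H) : ℂ) * χ g * ψ g⁻¹ = 0 := by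
    refine Finset.sum_eq_zero fun l _ => ?_
    have := htw l
    rw [charPair, mul_eq_zero] at this
    exact this.resolve_left (inv_ne_zero (Nat.cast_ne_zero.2 Fintype.card_ne_zero))
  -- Summing over all l annihilates the terms outside H and leaves a nonzero multiple of the pairing
  -- over H.
  have hval : ∀ g : Γ, ∑ l : Γ ⧸ H →* ℂˣ, (l (g : Γ ⧸ H) : ℂ) * χ g * ψ g⁻¹ =
      (χ g * ψ g⁻¹) * extendByZero (fun _ : H => (Fintype.card (Γ ⧸ H →* ℂˣ) : ℂ)) g := by
    intro g
    simp only [mul_assoc]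
    rw [← Finset.sum_mul]
    by_cases hg : g ∈ H
    · have h1 : (g : Γ ⧸ H) = 1 := (QuotientGroup.eq_one_iff _).2 hg
      simp [h1, extendByZero, hg]
      ring
    · rw [sum_characters_quotient H g hg, extendByZero_of_notMem _ hg]
      ring
  rw [Finset.sum_comm, Finset.sum_congr rfl fun g _ => hval g, sum_mul_extendByZero,
    ← Finset.sum_mul, mul_eq_zero] at hsum
  have := hsum.resolve_right (Nat.cast_ne_zero.2 Fintype.card_ne_zero)
  rw [charPair]
  simp only [InvMemClass.coe_inv, this, mul_zero]

/-- The norm is the dimension of the space of H-endomorphisms, which contains the nonzero identity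
map. -/
theorem exists_charPair_restriction_self [Fintype Γ] (H : Subgroup Γ) [Fintype H] {χ : Γ → ℂ}
    (hχ : χ ∈ irrChars Γ) :
    ∃ a : ℕ, 0 < a ∧ charPair (fun h : H => χ h) (fun h : H => χ h) = a := by
  have hd := irrChars.exists_degree hχ
  obtain ⟨V, _, _, _, ρ, hρ, rfl⟩ := hχ
  obtain ⟨d, hd, hρd⟩ := hd
  let σ : Representation ℂ H V := ρ.comp H.subtype
  refine ⟨_, ?_, charPair_character σ σ⟩
  have : Module.Finite ℂ (Representation.IntertwiningMap σ σ) :=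
    Module.Finite.equiv (Representation.invariantsEquivIntertwiningMap σ σ)
  have : Nontrivial V := by
    rw [Representation.char_one, Nat.cast_inj] at hρd
    exact Module.nontrivial_of_finrank_pos (R := ℂ) (hρd ▸ hd)
  have : Nontrivial (Representation.IntertwiningMap σ σ) := by
    refine ⟨Representation.IntertwiningMap.id σ, 0, fun h => ?_⟩
    obtain ⟨v, hv⟩ := exists_ne (0 : V)
    exact hv (DFunLike.congr_fun h v)
  exact Module.finrank_pos

theorem isMcKayFamily_restrictedChars [Fintype Γ] {φ : Γ →* SU2} (hφ : Function.Injective φ)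
    (H : Subgroup Γ) [H.Normal] [IsCyclic (Γ ⧸ H)] [Fintype H] (heven : Even (Nat.card H)) {r : ℕ}
    {χ : Fin (r + 1) → H → ℂ} (hχ : Enumerates χ (restrictedChars H)) (h0 : χ 0 = 1) :
    IsMcKayFamily (φ.comp H.subtype) χ := by
  have hinj : Function.Injective (φ.comp H.subtype) := hφ.comp Subtype.val_injective
  have hmem : ∀ i, ∃ ψ ∈ irrChars Γ, χ i = fun h : H => ψ h := fun i =>
    (mem_restrictedChars_iff H _).1 (hχ.2 ▸ Set.mem_range_self i)
  choose ψ hψ hχψ using hmem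
  obtain ⟨z, hz⟩ := exists_coe_eq_neg_one _ hinj heven
  have hz' : (φ (z : Γ) : Matrix (Fin 2) (Fin 2) ℂ) = -1 := hz
  have horth : ∀ i j, i ≠ j → charPair (χ i) (χ j) = 0 := fun i j hij => by
    by_contra h
    apply hij
    apply hχ.1
    rw [hχψ i, hχψ j] at h ⊢
    exact funext fun x => restriction_eq_of_charPair_ne_zero H (hψ i) (hψ j) h x
  exact
  { injective := hinj
    orthogonal := horth
    norm := ⟨1, one_ne_zero, fun i => by
      rw [hχψ i]
      simpa using exists_charPair_restriction_self H (hψ i)⟩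
    degree := fun i => by
      rw [hχψ i]
      exact irrChars.exists_degree (hψ i)
    parity := ⟨z, hz, fun i => by
      rw [hχψ i]
      exact (irrChars.parity (hψ i) (sq_eq_one_of_coe_eq_neg_one φ hφ hz')
        (commute_of_coe_eq_neg_one φ hφ hz')).imp (fun h g => h g) (fun h g => h g)⟩
    pair_one := fun i => by
      split_ifs with hi
      · rw [hi, h0]
        simp [charPair]
      · rw [← h0, horth 0 i (Ne.symm hi)]
    conj_zero := by simp [h0] }

theorem stdChar_mul_mem_closure_restrictedChars [Finite Γ] (φ : Γ →* SU2) (H : Subgroup Γ)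
    {χ : H → ℂ} (hχ : χ ∈ restrictedChars H) :
    (fun h => stdChar (φ.comp H.subtype) h * χ h) ∈
      AddSubmonoid.closure (restrictedChars H) := by
  obtain ⟨ψ, hψ, rfl⟩ := (mem_restrictedChars_iff H χ).1 hχ
  let res : (Γ → ℂ) →+ (H → ℂ) :=
    { toFun := fun f h => f h
      map_zero' := rfl
      map_add' := fun _ _ => rfl }
  have h := AddSubmonoid.mem_map_of_mem res (stdChar_mul_mem_closure_irrChars φ hψ)
  rw [AddMonoidHom.map_mclosure] at h
  refine AddSubmonoid.closure_mono ?_ h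
  rintro _ ⟨ψ', hψ', rfl⟩
  exact (mem_restrictedChars_iff H _).2 ⟨ψ', hψ', rfl⟩

/-! ### The Slodowy operator of induced representations -/

theorem mem_inducedChars_iff [Fintype Γ] (H : Subgroup Γ) [Fintype H] (χ : Γ → ℂ) :
    χ ∈ inducedChars H ↔ ∃ τ ∈ irrChars H, χ = indFun τ := by
  constructor
  · rintro ⟨V, _, _, _, τ, hτ, rfl⟩
    exact ⟨τ.character, ⟨V, _, _, inferInstance, τ, hτ, rfl⟩, character_ind τ⟩
  · rintro ⟨_, ⟨V, _, _, _, τ, hτ, rfl⟩, rfl⟩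
    exact ⟨V, _, _, inferInstance, τ, hτ, (character_ind τ).symm⟩

section IndFun

variable [Fintype Γ] {H : Subgroup Γ} [Fintype H]

theorem indFun_conj (f : H → ℂ) (y g : Γ) : indFun f (y * g * y⁻¹) = indFun f g := by
  rw [indFun_apply, indFun_apply]
  congr 1
  rw [← Equiv.sum_comp (Equiv.mulRight y) fun x => extendByZero f (x * g * x⁻¹)]
  refine Finset.sum_congr rfl fun x _ => ?_
  simp [mul_assoc]

/-- Frobenius reciprocity. -/
theorem charPair_indFun (α : Γ → ℂ) (hα : ∀ x g, α (x * g * x⁻¹) = α g) (f : H → ℂ) :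
    charPair α (indFun f) = charPair (fun h : H => α h) f := by
  -- As α is a class function, the substitution y = x g⁻¹ x⁻¹ makes the inner sum independent of x,
  -- and the sum over x only contributes |Γ|.
  have h1 : ∀ x : Γ, ∑ g, α g * extendByZero f (x * g⁻¹ * x⁻¹) = ∑ h : H, α (h : Γ)⁻¹ * f h := by
    intro x
    rw [← sum_mul_extendByZero (fun y => α y⁻¹),
      ← Equiv.sum_comp ((Equiv.inv Γ).trans (MulAut.conj x).toEquiv)
        fun y => α y⁻¹ * extendByZero f y]
    refine Finset.sum_congr rfl fun g _ => ?_
    have h : α (x * g⁻¹ * x⁻¹)⁻¹ = α g := by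
      rw [← hα x g]
      simp [mul_assoc]
    change _ = α (x * g⁻¹ * x⁻¹)⁻¹ * extendByZero f (x * g⁻¹ * x⁻¹)
    rw [h]
  have h2 : ∑ g, α g * indFun f g⁻¹ =
      (Fintype.card H : ℂ)⁻¹ * ∑ x : Γ, ∑ g, α g * extendByZero f (x * g⁻¹ * x⁻¹) := by
    rw [Finset.sum_comm, Finset.mul_sum]
    refine Finset.sum_congr rfl fun g _ => ?_
    rw [indFun_apply, ← Finset.mul_sum]
    ring
  rw [charPair, h2, charPair_comm, charPair]
  simp only [h1, Finset.sum_const, Finset.card_univ, nsmul_eq_mul, InvMemClass.coe_inv]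
  have hc : (Fintype.card Γ : ℂ) ≠ 0 := Nat.cast_ne_zero.2 Fintype.card_ne_zero
  rw [mul_left_comm, inv_mul_cancel_left₀ hc]
  simp only [mul_comm]

/-- Normality keeps every conjugate of h inside H, so no term is cut off. This is Mackey's formula
for restricting an induced character back to H. -/
theorem indFun_coe [H.Normal] (f : H → ℂ) (h : H) :
    indFun f (h : Γ) = ∑ x : Γ, (Fintype.card H : ℂ)⁻¹ * f (MulAut.conjNormal x h) := by
  rw [indFun_apply, Finset.mul_sum]
  refine Finset.sum_congr rfl fun x _ => ?_
  rw [← MulAut.conjNormal_apply, extendByZero_coe]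

-- Frobenius reciprocity and Mackey's formula turn the pairing into a sum over conjugates of τ, and
-- each conjugate is again irreducible. The pairing vanishes unless τ' is conjugate to τ.
open scoped Classical in
theorem card_mul_charPair_indFun [H.Normal] {τ τ' : H → ℂ} (hτ : τ ∈ irrChars H)
    (hτ' : τ' ∈ irrChars H) : Fintype.card H * charPair (indFun τ) (indFun τ') =
      ((Finset.univ.filter fun x : Γ => (fun h => τ (MulAut.conjNormal x h)) = τ').card : ℂ) := by
  rw [charPair_indFun _ (indFun_conj τ)]
  simp only [indFun_coe]
  rw [charPair_sum_left Finset.univ (fun _ => (Fintype.card H : ℂ)⁻¹)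
    (fun (x : Γ) h => τ (MulAut.conjNormal x h)), ← Finset.mul_sum,
    mul_inv_cancel_left₀ (Nat.cast_ne_zero.2 Fintype.card_ne_zero), Finset.card_filter,
    Nat.cast_sum]
  refine Finset.sum_congr rfl fun x _ => ?_
  rw [charPair_irrChars (irrChars.comp_mulEquiv hτ (MulAut.conjNormal x)) hτ']
  split_ifs <;> simp

/-- The conjugation is absorbed by reindexing the sum over Γ. Hence distinct induced characters come
from non-conjugate τ and are orthogonal. -/
theorem indFun_comp_conjNormal [H.Normal] (τ : H → ℂ) (x : Γ) :
    indFun (fun h => τ (MulAut.conjNormal x h)) = indFun τ := by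
  have hext : ∀ y, extendByZero (fun h => τ (MulAut.conjNormal x h)) y =
      extendByZero τ (x * y * x⁻¹) := fun y => by
    by_cases hy : y ∈ H
    · have h1 := extendByZero_coe (fun h => τ (MulAut.conjNormal x h)) ⟨y, hy⟩
      have h2 := extendByZero_coe τ (MulAut.conjNormal x ⟨y, hy⟩)
      rw [MulAut.conjNormal_apply] at h2
      exact h1.trans h2.symm
    · rw [extendByZero_of_notMem _ hy, extendByZero_of_notMem]
      intro h
      have := Subgroup.Normal.conj_mem ‹H.Normal› _ h x⁻¹
      exact hy (by simpa [mul_assoc] using this)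
  ext g
  rw [indFun_apply, indFun_apply,
    ← Equiv.sum_comp (Equiv.mulLeft x) fun y => extendByZero τ (y * g * y⁻¹)]
  congr 1
  refine Finset.sum_congr rfl fun y _ => ?_
  rw [hext]
  simp [mul_assoc]

/-- The character of ρ is constant on conjugacy classes, so it may be moved into the sum (projection
formula). Decompositions over H therefore induce to decompositions over Γ. -/
theorem stdChar_mul_indFun (φ : Γ →* SU2) (f : H → ℂ) :
    (fun g => stdChar φ g * indFun f g) =
      indFun fun h => stdChar (φ.comp H.subtype) h * f h := by
  ext g
  rw [indFun_apply, indFun_apply, mul_left_comm, Finset.mul_sum]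
  congr 1
  refine Finset.sum_congr rfl fun x _ => ?_
  by_cases hx : x * g * x⁻¹ ∈ H
  · rw [← stdChar_conj φ x g]
    simp [extendByZero, hx]
    simp [stdChar]
  · rw [extendByZero_of_notMem _ hx, extendByZero_of_notMem _ hx, mul_zero]

theorem indFun_central_mul (f : H → ℂ) {z : H} {ε : ℂ} (hz : ∀ g : Γ, (z : Γ) * g = g * z)
    (hf : ∀ h, f (z * h) = ε * f h) (g : Γ) : indFun f (z * g) = ε * indFun f g := by
  rw [indFun_apply, indFun_apply, mul_left_comm, Finset.mul_sum (a := ε)]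
  congr 1
  refine Finset.sum_congr rfl fun x _ => ?_
  have : x * (z * g) * x⁻¹ = z * (x * g * x⁻¹) := by
    rw [← mul_assoc x, ← hz]
    simp only [mul_assoc]
  rw [this]
  by_cases hx : x * g * x⁻¹ ∈ H
  · have h1 := extendByZero_coe f (z * ⟨x * g * x⁻¹, hx⟩)
    have h2 := extendByZero_coe f ⟨x * g * x⁻¹, hx⟩
    rw [hf, ← h2] at h1
    exact h1
  · rw [extendByZero_of_notMem _ hx, extendByZero_of_notMem, mul_zero]
    rwa [Subgroup.mul_mem_cancel_left _ z.2]

theorem indFun_apply_one (f : H → ℂ) : indFun f 1 = (H.index : ℂ) * f 1 := by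
  have h1 : extendByZero f 1 = f 1 := extendByZero_coe f 1
  have h2 : (Fintype.card Γ : ℂ) = Fintype.card H * H.index := by
    rw [← Nat.cast_mul, Fintype.card_eq_nat_card, Fintype.card_eq_nat_card, H.card_mul_index]
  have h3 : (Fintype.card H : ℂ) ≠ 0 := Nat.cast_ne_zero.2 Fintype.card_ne_zero
  rw [indFun_apply]
  simp only [mul_one, mul_inv_cancel, h1, Finset.sum_const, Finset.card_univ, nsmul_eq_mul, h2]
  rw [mul_assoc, inv_mul_cancel_left₀ h3]

theorem conj_indFun_one (g : Γ) :
    conj (indFun (1 : H → ℂ) g) = indFun (1 : H → ℂ) g⁻¹ := by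
  rw [indFun_apply, indFun_apply, map_mul, map_sum, map_inv₀, Complex.conj_natCast]
  congr 1
  refine Finset.sum_congr rfl fun x _ => ?_
  have : x * g⁻¹ * x⁻¹ = (x * g * x⁻¹)⁻¹ := by simp [mul_assoc]
  rw [this]
  by_cases hx : x * g * x⁻¹ ∈ H
  · have hx' : (x * g * x⁻¹)⁻¹ ∈ H := H.inv_mem hx
    simp only [extendByZero, dif_pos hx, dif_pos hx', Pi.one_apply, map_one]
  · have hx' : (x * g * x⁻¹)⁻¹ ∉ H := fun h => hx (H.inv_mem_iff.1 h)
    simp only [extendByZero, dif_neg hx, dif_neg hx', map_zero]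

end IndFun

theorem isMcKayFamily_inducedChars [Fintype Γ] {φ : Γ →* SU2} (hφ : Function.Injective φ)
    (H : Subgroup Γ) [H.Normal] [Fintype H] (heven : Even (Nat.card H)) {r : ℕ}
    {χ : Fin (r + 1) → Γ → ℂ} (hχ : Enumerates χ (inducedChars H))
    (h0 : χ 0 = indFun (1 : H → ℂ)) : IsMcKayFamily φ χ := by
  classical
  have hinj : Function.Injective (φ.comp H.subtype) := hφ.comp Subtype.val_injective
  have hmem : ∀ i, ∃ τ ∈ irrChars H, χ i = indFun τ := fun i =>
    (mem_inducedChars_iff H _).1 (hχ.2 ▸ Set.mem_range_self i)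
  choose τ hτ hχτ using hmem
  obtain ⟨z, hz⟩ := exists_coe_eq_neg_one _ hinj heven
  have hz' : (φ (z : Γ) : Matrix (Fin 2) (Fin 2) ℂ) = -1 := hz
  have hcard : (Fintype.card H : ℂ) ≠ 0 := Nat.cast_ne_zero.2 Fintype.card_ne_zero
  exact
  { injective := hφ
    orthogonal := fun i j hij => by
      have h := card_mul_charPair_indFun (hτ i) (hτ j)
      rw [Finset.card_eq_zero.2, Nat.cast_zero] at h
      · rw [hχτ i, hχτ j]
        exact (mul_eq_zero.1 h).resolve_left hcard
      · refine Finset.filter_eq_empty_iff.2 fun x _ hx => hij (hχ.1 ?_)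
        rw [hχτ i, hχτ j, ← hx, indFun_comp_conjNormal]
    -- |H| times the norm counts the x ∈ Γ that fix τ under conjugation; x = 1 is one of them.
    norm := ⟨Fintype.card H, Fintype.card_ne_zero, fun i => by
      rw [hχτ i]
      refine ⟨_, ?_, card_mul_charPair_indFun (hτ i) (hτ i)⟩
      exact Finset.card_pos.2 ⟨1, by simp⟩⟩
    degree := fun i => by
      obtain ⟨d, hd, h⟩ := irrChars.exists_degree (hτ i)
      refine ⟨H.index * d, Nat.mul_pos (Nat.pos_of_ne_zero Subgroup.index_ne_zero_of_finite) hd, ?_⟩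
      rw [hχτ i, indFun_apply_one, h, Nat.cast_mul]
    parity := ⟨z, hz', fun i => by
      rw [hχτ i]
      have hcomm := commute_of_coe_eq_neg_one φ hφ hz'
      refine (irrChars.parity (hτ i) (sq_eq_one_of_coe_eq_neg_one _ hinj hz)
        (commute_of_coe_eq_neg_one _ hinj hz)).imp (fun h g => ?_) (fun h g => ?_)
      · simpa using indFun_central_mul (τ i) (ε := 1) hcomm (by simpa using h) g
      · simpa using indFun_central_mul (τ i) (ε := -1) hcomm (by simpa using h) g⟩
    pair_one := fun i => by
      split_ifs with hi
      · rw [hi, h0, charPair_indFun _ (by simp)]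
        exact (charPair_irrChars one_mem_irrChars one_mem_irrChars).trans (if_pos rfl)
      · rw [hχτ i, charPair_indFun _ (by simp)]
        refine (charPair_irrChars one_mem_irrChars (hτ i)).trans (if_neg fun h => hi ?_)
        apply hχ.1
        rw [hχτ i, h0, ← h]
    conj_zero := fun g => by rw [h0, conj_indFun_one] }

theorem stdChar_mul_mem_closure_inducedChars [Fintype Γ] (φ : Γ →* SU2) (H : Subgroup Γ)
    [Fintype H] {χ : Γ → ℂ} (hχ : χ ∈ inducedChars H) :
    (fun g => stdChar φ g * χ g) ∈ AddSubmonoid.closure (inducedChars H) := by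
  obtain ⟨τ, hτ, rfl⟩ := (mem_inducedChars_iff H χ).1 hχ
  rw [stdChar_mul_indFun]
  have h := AddSubmonoid.mem_map_of_mem (indFun (H := H))
    (stdChar_mul_mem_closure_irrChars (φ.comp H.subtype) hτ)
  rw [AddMonoidHom.map_mclosure] at h
  refine AddSubmonoid.closure_mono ?_ h
  rintro _ ⟨τ', hτ', rfl⟩
  exact (mem_inducedChars_iff H _).2 ⟨τ', hτ', rfl⟩

/-- By Frobenius reciprocity, pairing π_n with the character induced from 1 counts the H-invariants
of degree n. -/
theorem kostantSeries_indFun_one [Fintype Γ] (φ : Γ →* SU2) (H : Subgroup Γ) [Fintype H] :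
    kostantSeries φ (indFun (1 : H → ℂ)) = poincareSeries (φ.comp H.subtype) := by
  rw [poincareSeries_eq]
  ext n
  rw [kostantSeries, PowerSeries.coeff_mk, PowerSeries.coeff_mk,
    charInner_eq_charPair _ _ conj_indFun_one,
    charPair_indFun _ fun x g => Representation.char_conj _ g x]
  rfl

end Families

/-! ### The generalized Ebeling theorem in its three cases. -/

theorem mainTheorem1 (G : Subgroup SU2) [Fintype G] :
    -- the McKay operator `A` of a binary polyhedral group
    (Even (Nat.card G) →
      ∀ (r : ℕ) (χ : Fin (r + 1) → G → ℂ), Enumerates χ (irrChars G) → χ 0 = trivialChar G →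
        (∃! A, IsTensorMatrix G.subtype χ A) ∧
        kostantSeries G.subtype (χ 0) = poincareSeries G.subtype ∧
        ∀ A, IsTensorMatrix G.subtype χ A →
          EbelingFormula A (poincareSeries G.subtype)) ∧
    (∀ (H : Subgroup G) [H.Normal] [IsCyclic (G ⧸ H)] [Fintype H], Even (Nat.card H) →
      -- the Slodowy operator of the restricted representations
      (∀ (r : ℕ) (χ : Fin (r + 1) → H → ℂ), Enumerates χ (restrictedChars H) →
        χ 0 = Representation.character ((Representation.trivial ℂ G ℂ).comp H.subtype) →
        (∃! B : Matrix (Fin (r + 1)) (Fin (r + 1)) ℕ,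
          IsTensorMatrix (G.subtype.comp H.subtype) χ B.transpose) ∧
        kostantSeries (G.subtype.comp H.subtype) (χ 0) =
          poincareSeries (G.subtype.comp H.subtype) ∧
        ∀ B : Matrix (Fin (r + 1)) (Fin (r + 1)) ℕ,
          IsTensorMatrix (G.subtype.comp H.subtype) χ B.transpose →
          EbelingFormula B (kostantSeries (G.subtype.comp H.subtype) (χ 0))) ∧
      -- the Slodowy operator of the induced representations
      (∀ (r : ℕ) (χ : Fin (r + 1) → G → ℂ), Enumerates χ (inducedChars H) →
        χ 0 = (Representation.ind H.subtype (Representation.trivial ℂ H ℂ)).character →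
        (∃! B : Matrix (Fin (r + 1)) (Fin (r + 1)) ℕ, IsTensorMatrix G.subtype χ B.transpose) ∧
        kostantSeries G.subtype (χ 0) = poincareSeries (G.subtype.comp H.subtype) ∧
        ∀ B : Matrix (Fin (r + 1)) (Fin (r + 1)) ℕ, IsTensorMatrix G.subtype χ B.transpose →
          EbelingFormula B (kostantSeries G.subtype (χ 0)))) := by
  have hG : Function.Injective G.subtype := Subtype.val_injective
  refine ⟨fun heven r χ hχ h0 => ?_, fun H _ _ _ heven =>
    ⟨fun r χ hχ h0 => ?_, fun r χ hχ h0 => ?_⟩⟩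
  · rw [trivialChar_eq_one] at h0
    have hm := isMcKayFamily_irrChars hG heven hχ h0
    have hk : kostantSeries G.subtype (χ 0) = poincareSeries G.subtype := by
      rw [h0, kostantSeries_one]
    refine ⟨existsUnique_isTensorMatrix hm fun i => ?_, hk, fun A hA => ?_⟩
    · rw [hχ.2]
      exact stdChar_mul_mem_closure_irrChars _ (hχ.2 ▸ Set.mem_range_self i)
    · rw [← hk]
      apply hm.ebelingFormula
      -- The McKay matrix is symmetric, so the transposed convention of `ebelingFormula` does no
      -- harm.
      rwa [tensorMatrix_irrChars_transpose hχ hm hA]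
  · have h0' : χ 0 = 1 := h0.trans (funext fun h => congrFun (trivialChar_eq_one (Γ := G)) h)
    have hm := isMcKayFamily_restrictedChars hG H heven hχ h0'
    refine ⟨existsUnique_isTensorMatrix_transpose hm fun i => ?_, ?_, fun B hB =>
      hm.ebelingFormula hB⟩
    · rw [hχ.2]
      exact stdChar_mul_mem_closure_restrictedChars _ H (hχ.2 ▸ Set.mem_range_self i)
    · rw [h0', kostantSeries_one]
  · have h0' : χ 0 = indFun (1 : H → ℂ) := by
      rw [h0, character_ind, ← trivialChar_eq_one]
      rfl
    have hm := isMcKayFamily_inducedChars hG H heven hχ h0'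
    refine ⟨existsUnique_isTensorMatrix_transpose hm fun i => ?_, ?_, fun B hB =>
      hm.ebelingFormula hB⟩
    · rw [hχ.2]
      exact stdChar_mul_mem_closure_inducedChars _ H (hχ.2 ▸ Set.mem_range_self i)
    · rw [h0', kostantSeries_indFun_one]
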